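/- Let $\mathcal H,\mathcal K$ be complex Hilbert spaces. A linear operator $D$ in $\mathcal H$ is called m-accretive if for all $\zeta\in\mathbb C$ with $\operatorname{Re}\zeta>0$ one has $(D+\zeta I)^{-1}\in\mathcal B(\mathcal H)$ and $\|(D+\zeta I)^{-1}\|\le(\operatorname{Re}\zeta)^{-1}$. Its square root $D^{1/2}$ is the closure of the operator $$\operatorname{dom}(D)\ni u\mapsto\frac1\pi\int_0^\infty\lambda^{-1/2}(D+\lambda I)^{-1}Du\,d\lambda ,$$ and $(D+\mu I)^{-1/2}$ is the inverse of $(D+\mu I)^{1/2}$ for $\mu>0$. A bar denotes the closure of an operator. Let $T_0$ be a densely defined closed operator in $\mathcal H$ with $\rho(T_0)\neq\emptyset$, and let $A,B$ be densely defined closed operators from $\mathcal H$ to $\mathcal K$ with $\operatorname{dom}(A)\supseteq\operatorname{dom}(T_0)$ and $\operatorname{dom}(B)\supseteq\operatorname{dom}(T_0^*)$. Assume that for some (and hence for all) $z\in\rho(T_0)$ the operator $-A(T_0-zI)^{-1}B^*$, defined on $\operatorname{dom}(B^*)$, has a bounded extension in $\mathcal K$, put $K(z)=\overline{-A(T_0-zI)^{-1}B^*}\in\mathcal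 B(\mathcal K)$, and assume that $\Omega=\{z\in\rho(T_0):1\in\rho(K(z))\}$ is nonempty. Let $T$ be the operator in $\mathcal H$ defined by $$(T-zI)^{-1}=(T_0-zI)^{-1}-\overline{(T_0-zI)^{-1}B^*}\,[I-K(z)]^{-1}A(T_0-zI)^{-1},\qquad z\in\Omega$$ (any single $z\in\Omega$ determines $T$, and $T$ does not depend on the choice of $z$). Assume moreover that $T_0$ is m-accretive, that $\operatorname{dom}(A)\supseteq\operatorname{dom}(T_0^{1/2})$ and $\operatorname{dom}(B)\supseteq\operatorname{dom}((T_0^*)^{1/2})$, and that, with $$N(\mu)=\big\|A(T_0+\mu I)^{-1/2}\big\|_{\mathcal B(\mathcal H,\mathcal K)}\,\big\|\overline{(T_0+\mu I)^{-1/2}B^*}\big\|_{\mathcal B(\mathcal K,\mathcal H)},\qquad \mu>0,$$ there are constants $R>0$ and $E_0>0$ such that $$\int_R^\infty\lambda^{-1}N(\lambda+E)\,d\lambda<\infty\ \text{ for all }E\ge E_0,\qquad \lim_{E\to\infty}\int_R^\infty\lambda^{-1}N(\lambda+E)\,d\lambda=0,\qquad \lim_{E\to\infty}N(E)=0 .$$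 If $T$ is m-accretive, then $\operatorname{dom}(T^{1/2})=\operatorname{dom}(T_0^{1/2})$. -/

import Mathlib

open scoped ENNReal Topology

noncomputable section

namespace SqrtDomain

section General

variable {E F G : Type*}
  [NormedAddCommGroup E] [InnerProductSpace ℂ E]
  [NormedAddCommGroup F] [InnerProductSpace ℂ F]
  [NormedAddCommGroup G] [InnerProductSpace ℂ G]

/-- The product `g f` of two unbounded operators, on its natural domain
`{x ∈ dom f | f x ∈ dom g}`. -/
def comp (g : F →ₗ.[ℂ] G) (f : E →ₗ.[ℂ] F) : E →ₗ.[ℂ] G where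
  domain :=
    { carrier := {x | ∃ h : x ∈ f.domain, f ⟨x, h⟩ ∈ g.domain}
      add_mem' := by
        rintro x y ⟨hx, hgx⟩ ⟨hy, hgy⟩
        refine ⟨f.domain.add_mem hx hy, ?_⟩
        have : f ⟨x + y, f.domain.add_mem hx hy⟩ = f ⟨x, hx⟩ + f ⟨y, hy⟩ :=
          f.map_add ⟨x, hx⟩ ⟨y, hy⟩
        rw [this]
        exact g.domain.add_mem hgx hgy
      zero_mem' := by
        refine ⟨f.domain.zero_mem, ?_⟩
        have : f ⟨0, f.domain.zero_mem⟩ = 0 := f.map_zero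
        rw [this]
        exact g.domain.zero_mem
      smul_mem' := by
        rintro c x ⟨hx, hgx⟩
        refine ⟨f.domain.smul_mem c hx, ?_⟩
        have : f ⟨c • x, f.domain.smul_mem c hx⟩ = c • f ⟨x, hx⟩ := f.map_smul c ⟨x, hx⟩
        rw [this]
        exact g.domain.smul_mem c hgx }
  toFun :=
    { toFun := fun x => g ⟨f ⟨x, x.2.1⟩, x.2.2⟩
      map_add' := fun x y => by
        rw [← g.map_add]
        congr 1
        exact Subtype.ext (f.map_add ⟨x, x.2.1⟩ ⟨y, y.2.1⟩)
      map_smul' := fun c x => by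
        rw [RingHom.id_apply, ← g.map_smul]
        congr 1
        exact Subtype.ext (f.map_smul c ⟨x, x.2.1⟩) }

/-- A bounded operator, regarded as an unbounded operator with full domain. -/
def ofBounded (S : E →L[ℂ] F) : E →ₗ.[ℂ] F := (S : E →ₗ[ℂ] F).toPMap ⊤

/-- The operator `D + c I`, with domain `dom D`. -/
def addScalar (D : E →ₗ.[ℂ] E) (c : ℂ) : E →ₗ.[ℂ] E where
  domain := D.domain
  toFun := D.toFun + c • D.domain.subtype

/-- The operator norm of a not necessarily bounded or everywhere defined operator,
with values in `[0, ∞]`. -/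
def opNorm (f : E →ₗ.[ℂ] F) : ℝ≥0∞ := ⨆ x : {x : f.domain // ‖(x : E)‖ ≤ 1}, ‖f x.1‖ₑ

/-- The bounded operator `S` extends `f`. -/
def IsBoundedExtension (f : E →ₗ.[ℂ] F) (S : E →L[ℂ] F) : Prop := ∀ x : f.domain, S x = f x

open Classical in
/-- The closure of a densely defined bounded operator, as an everywhere defined bounded
operator: the closure of such an `f` is its only bounded everywhere defined extension.
(The value is `0` if `f` is not densely defined or not bounded.) -/
def boundedClosure (f : E →ₗ.[ℂ] F) : E →L[ℂ] F :=
  if h : Dense (f.domain : Set E) ∧ ∃ S : E →L[ℂ] F, IsBoundedExtension f S then h.2.choose else 0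

/-- `R` is the bounded everywhere defined two-sided inverse of `D - z I`. -/
def IsResolvent (D : E →ₗ.[ℂ] E) (z : ℂ) (R : E →L[ℂ] E) : Prop :=
  (∀ x : E, ∃ h : R x ∈ D.domain, D ⟨R x, h⟩ - z • R x = x) ∧
    ∀ u : D.domain, R (D u - z • (u : E)) = u

/-- The resolvent set `ρ(D)` of an unbounded operator. -/
def resolventSet (D : E →ₗ.[ℂ] E) : Set ℂ := {z | ∃ R : E →L[ℂ] E, IsResolvent D z R}

open Classical in
/-- The resolvent `(D - z I)⁻¹` for `z ∈ ρ(D)` (and `0` for other `z`). -/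
def resolvent (D : E →ₗ.[ℂ] E) (z : ℂ) : E →L[ℂ] E :=
  if h : z ∈ resolventSet D then h.choose else 0

/-- `D` is m-accretive: for `Re ζ > 0`, `D + ζ I` has a bounded everywhere defined inverse with
`‖(D + ζ I)⁻¹‖ ≤ 1 / Re ζ`. -/
def IsMAccretive (D : E →ₗ.[ℂ] E) : Prop :=
  ∀ ζ : ℂ, 0 < ζ.re → -ζ ∈ resolventSet D ∧ ‖resolvent D (-ζ)‖ ≤ (ζ.re)⁻¹

end General

section Sqrt

variable {H : Type*} [NormedAddCommGroup H] [InnerProductSpace ℂ H]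

/-- The integrand `lam ^ (-1/2) (D + lam I)⁻¹ D u` of Balakrishnan's formula. -/
def sqrtIntegrand (D : H →ₗ.[ℂ] H) (u : D.domain) (lam : ℝ) : H :=
  ((lam ^ (-(1 / 2) : ℝ) : ℝ) : ℂ) • resolvent D (-(lam : ℂ)) (D u)

lemma sqrtIntegrand_add (D : H →ₗ.[ℂ] H) (u v : D.domain) :
    sqrtIntegrand D (u + v) = sqrtIntegrand D u + sqrtIntegrand D v := by
  funext lam
  simp [sqrtIntegrand, D.map_add]

lemma sqrtIntegrand_smul (D : H →ₗ.[ℂ] H) (c : ℂ) (u : D.domain) :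
    sqrtIntegrand D (c • u) = c • sqrtIntegrand D u := by
  funext lam
  simp [sqrtIntegrand, D.map_smul, smul_comm c]

/-- Balakrishnan's operator `u ↦ (1/π) ∫₀^∞ lam ^ (-1/2) (D + lam I)⁻¹ D u dlam`, defined for those
`u ∈ dom D` for which the integral converges absolutely; for an m-accretive `D` these are all
`u ∈ dom D`. -/
def balakrishnan (D : H →ₗ.[ℂ] H) : H →ₗ.[ℂ] H where
  domain :=
    { carrier := {u | ∃ h : u ∈ D.domain,
        MeasureTheory.IntegrableOn (sqrtIntegrand D ⟨u, h⟩) (Set.Ioi 0)}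
      add_mem' := by
        rintro u v ⟨hu, hiu⟩ ⟨hv, hiv⟩
        refine ⟨D.domain.add_mem hu hv, ?_⟩
        have := sqrtIntegrand_add D ⟨u, hu⟩ ⟨v, hv⟩
        rw [show (⟨u + v, D.domain.add_mem hu hv⟩ : D.domain) = ⟨u, hu⟩ + ⟨v, hv⟩ from rfl, this]
        exact hiu.add hiv
      zero_mem' := by
        refine ⟨D.domain.zero_mem, ?_⟩
        have h0 : sqrtIntegrand D ⟨0, D.domain.zero_mem⟩ = 0 := by
          have := sqrtIntegrand_smul D 0 0
          rw [zero_smul, zero_smul] at this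
          exact this
        rw [h0]
        exact MeasureTheory.integrableOn_zero
      smul_mem' := by
        rintro c u ⟨hu, hiu⟩
        refine ⟨D.domain.smul_mem c hu, ?_⟩
        have := sqrtIntegrand_smul D c ⟨u, hu⟩
        rw [show (⟨c • u, D.domain.smul_mem c hu⟩ : D.domain) = c • ⟨u, hu⟩ from rfl, this]
        exact MeasureTheory.Integrable.smul c hiu }
  toFun :=
    { toFun := fun u =>
        ((Real.pi⁻¹ : ℝ) : ℂ) • ∫ lam in Set.Ioi (0 : ℝ), sqrtIntegrand D ⟨u, u.2.1⟩ lam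
      map_add' := fun u v => by
        have h := sqrtIntegrand_add D ⟨u, u.2.1⟩ ⟨v, v.2.1⟩
        rw [← smul_add, ← MeasureTheory.integral_add u.2.2 v.2.2]
        exact congrArg (fun f : ℝ → H =>
          ((Real.pi⁻¹ : ℝ) : ℂ) • ∫ lam in Set.Ioi (0 : ℝ), f lam) h
      map_smul' := fun c u => by
        have h := sqrtIntegrand_smul D c ⟨u, u.2.1⟩
        rw [RingHom.id_apply, smul_comm c, ← MeasureTheory.integral_smul c]
        exact congrArg (fun f : ℝ → H =>
          ((Real.pi⁻¹ : ℝ) : ℂ) • ∫ lam in Set.Ioi (0 : ℝ), f lam) h }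

/-- The square root `D^{1/2}` of an m-accretive operator: the closure of Balakrishnan's operator. -/
def sqrt (D : H →ₗ.[ℂ] H) : H →ₗ.[ℂ] H := (balakrishnan D).closure

/-- The operator `(D + μ I)^{-1/2}`, the inverse of the square root of `D + μ I`. -/
def invSqrt (D : H →ₗ.[ℂ] H) (μ : ℝ) : H →ₗ.[ℂ] H := (sqrt (addScalar D (μ : ℂ))).inverse

end Sqrt

section Perturbation

variable {H K : Type*}
  [NormedAddCommGroup H] [InnerProductSpace ℂ H] [CompleteSpace H]
  [NormedAddCommGroup K] [InnerProductSpace ℂ K]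

/-- The operator `-A (T₀ - z I)⁻¹ B*`, defined on `dom B*` if `dom A ⊇ dom T₀`. -/
def preBS (T₀ : H →ₗ.[ℂ] H) (A B : H →ₗ.[ℂ] K) (z : ℂ) : K →ₗ.[ℂ] K :=
  -(comp A (comp (ofBounded (resolvent T₀ z)) B.adjoint))

/-- The bounded operator `K(z)`, the closure of `-A (T₀ - z I)⁻¹ B*`. -/
def birmanSchwinger (T₀ : H →ₗ.[ℂ] H) (A B : H →ₗ.[ℂ] K) (z : ℂ) : K →L[ℂ] K :=
  boundedClosure (preBS T₀ A B z)

/-- The set `{z ∈ ρ(T₀) | 1 ∈ ρ(K(z))}`. -/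
def katoSet (T₀ : H →ₗ.[ℂ] H) (A B : H →ₗ.[ℂ] K) : Set ℂ :=
  {z | z ∈ resolventSet T₀ ∧ (1 : ℂ) ∈ _root_.resolventSet ℂ (birmanSchwinger T₀ A B z)}

/-- `R(z) = (T₀ - z)⁻¹ - closure((T₀ - z)⁻¹ B*) (I - K(z))⁻¹ A (T₀ - z)⁻¹`. The last factor is
everywhere defined, and bounded if `A` is closed, so that `boundedClosure` only turns it into an
element of `H →L[ℂ] K`. -/
def katoResolvent (T₀ : H →ₗ.[ℂ] H) (A B : H →ₗ.[ℂ] K) (z : ℂ) : H →L[ℂ] H :=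
  resolvent T₀ z -
    boundedClosure (comp (ofBounded (resolvent T₀ z)) B.adjoint) ∘L
      Ring.inverse (1 - birmanSchwinger T₀ A B z) ∘L
        boundedClosure (comp A (ofBounded (resolvent T₀ z)))

/-- The operator `T` with `(T - z I)⁻¹ = R(z)`, that is, `T = R(z)⁻¹ + z I`. -/
def katoOperator (T₀ : H →ₗ.[ℂ] H) (A B : H →ₗ.[ℂ] K) (z : ℂ) : H →ₗ.[ℂ] H :=
  addScalar (ofBounded (katoResolvent T₀ A B z)).inverse z

/-- The hypotheses under which the perturbed operator is defined. -/
structure KatoHypotheses (T₀ : H →ₗ.[ℂ] H) (A B : H →ₗ.[ℂ] K) : Prop where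
  dense_T₀ : Dense (T₀.domain : Set H)
  closed_T₀ : T₀.IsClosed
  nonempty_resolventSet : (resolventSet T₀).Nonempty
  dense_A : Dense (A.domain : Set H)
  closed_A : A.IsClosed
  dense_B : Dense (B.domain : Set H)
  closed_B : B.IsClosed
  dom_A : T₀.domain ≤ A.domain
  dom_B : T₀.adjoint.domain ≤ B.domain
  bounded : ∃ z ∈ resolventSet T₀, ∃ S : K →L[ℂ] K, IsBoundedExtension (preBS T₀ A B z) S
  one_mem : (katoSet T₀ A B).Nonempty

/-- `‖A (T₀ + μ)^{-1/2}‖ ‖closure((T₀ + μ)^{-1/2} B*)‖`. -/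
def normProduct (T₀ : H →ₗ.[ℂ] H) (A B : H →ₗ.[ℂ] K) (μ : ℝ) : ℝ≥0∞ :=
  opNorm (comp A (invSqrt T₀ μ)) * opNorm (comp (invSqrt T₀ μ) B.adjoint).closure

/-- `∫_R^∞ lam⁻¹ ‖A (T₀ + lam + E)^{-1/2}‖ ‖closure((T₀ + lam + E)^{-1/2} B*)‖ dlam`. -/
def decayIntegral (T₀ : H →ₗ.[ℂ] H) (A B : H →ₗ.[ℂ] K) (R E : ℝ) : ℝ≥0∞ :=
  ∫⁻ lam in Set.Ioi R, ENNReal.ofReal lam⁻¹ * normProduct T₀ A B (lam + E)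

/-- The hypotheses on `T₀`, `A`, `B` that concern square roots. -/
structure SqrtHypotheses (T₀ : H →ₗ.[ℂ] H) (A B : H →ₗ.[ℂ] K) : Prop where
  mAccretive : IsMAccretive T₀
  dom_A : (sqrt T₀).domain ≤ A.domain
  dom_B : (sqrt T₀.adjoint).domain ≤ B.domain
  decay : ∃ R > 0, ∃ E₀ > 0,
    (∀ E ≥ E₀, decayIntegral T₀ A B R E < ∞) ∧
    Filter.Tendsto (fun E => decayIntegral T₀ A B R E) Filter.atTop (𝓝 0) ∧
    Filter.Tendsto (fun E => normProduct T₀ A B E) Filter.atTop (𝓝 0)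

end Perturbation

end SqrtDomain

end

/-!
For an m-accretive `D` the operator `(D + t)^{-1/2}` is the norm-convergent integral
`(1/π) ∫₀^∞ x ^ (-1/2) (D + x + t)⁻¹ dx`; it squares to `(D + t)⁻¹`
(`IsPseudoResolvent.resolventSqrt_mul_self`), its inverse is the closure of Balakrishnan's operator
for `D + t` (`invSqrt_eq`), and the domain of `D^{1/2}` is its range, for every `t > 0`
(`mem_sqrt_domain_iff`), because `(D + t)^{1/2} - D^{1/2}` is bounded. So it suffices to show that
`(T + E)^{-1/2}` and `(T₀ + E)^{-1/2}` have the same range for one `E`.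

For large `μ`, Kato's formula at the point `-μ` factors through `(T₀ + μ)^{-1/2}`:
`(T + μ)⁻¹ = (T₀ + μ)⁻¹ - (T₀ + μ)^{-1/2} Φ (I + Γ Φ)⁻¹ Γ (T₀ + μ)^{-1/2}` with `‖Γ‖ ‖Φ‖ ≤ N(μ)`,
where `Γ = A (T₀ + μ)^{-1/2}` and `Φ` is the closure of `(T₀ + μ)^{-1/2} B*`. Here
`IsKatoData.isResolvent_katoOperator` provides the passage from the point `z` which defines `T` to
`-μ`. Since `‖(T₀ + E)^{1/2} (T₀ + μ)^{-1/2}‖ ≤ 2` for `μ ≥ E`, the correction is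
`(T₀ + E)^{-1/2} Y` with `‖Y‖ ≤ 4 N(μ) μ^{-1/2}` (`exists_kato_correction`). Integrating over
`μ = x + E` with the weight `x ^ (-1/2)` gives `(T + E)^{-1/2} = (T₀ + E)^{-1/2} (I - M)`, where the
decay of `N` makes `‖M‖ < 1` for large `E`; as `I - M` is invertible, the ranges agree
(`sqrt_domain_eq_of_lintegral_le`).
-/

noncomputable section

namespace SqrtDomain

open MeasureTheory Set Filter

/-! ### The weight of Balakrishnan's formula -/

lemma continuousOn_rpow_weight : ContinuousOn (fun x : ℝ => x ^ (-(1 / 2) : ℝ)) (Ioi 0) :=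
  ContinuousOn.rpow_const continuousOn_id fun _ hx => Or.inl (ne_of_gt hx)

lemma rpow_weight_eq {x : ℝ} (hx : 0 < x) : x ^ (-(1 / 2) : ℝ) = (√x)⁻¹ := by
  rw [Real.rpow_neg hx.le, Real.sqrt_eq_rpow]

section Weight

variable {t : ℝ}

lemma hasDerivAt_arctan_sqrt (ht : 0 < t) {x : ℝ} (hx : 0 < x) :
    HasDerivAt (fun y => 2 / √t * Real.arctan (√y / √t)) (x ^ (-(1 / 2) : ℝ) * (x + t)⁻¹) x := by
  have h1 := (((Real.hasDerivAt_sqrt hx.ne').div_const (√t)).arctan).const_mul (2 / √t)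
  convert! h1 using 1
  rw [rpow_weight_eq hx, div_pow, Real.sq_sqrt hx.le, Real.sq_sqrt ht.le]
  have hs := Real.sqrt_pos.2 ht
  have hsx := Real.sqrt_pos.2 hx
  have hst := Real.sq_sqrt ht.le
  field_simp
  rw [hst]
  ring

lemma tendsto_arctan_sqrt (ht : 0 < t) :
    Tendsto (fun y => 2 / √t * Real.arctan (√y / √t)) atTop (𝓝 (Real.pi * (√t)⁻¹)) := by
  have hs := Real.sqrt_pos.2 ht
  have h2 : Tendsto (fun y : ℝ => √y / √t) atTop atTop :=
    Real.tendsto_sqrt_atTop.atTop_div_const hs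
  have h3 := (tendsto_nhds_of_tendsto_nhdsWithin Real.tendsto_arctan_atTop).comp h2
  have h4 := h3.const_mul (2 / √t)
  convert! h4 using 2
  field_simp

lemma continuousWithinAt_arctan_sqrt :
    ContinuousWithinAt (fun y => 2 / √t * Real.arctan (√y / √t)) (Ici 0) 0 := by
  apply Continuous.continuousWithinAt
  fun_prop

lemma weight_nonneg (ht : 0 < t) : ∀ x ∈ Ioi (0 : ℝ), 0 ≤ x ^ (-(1 / 2) : ℝ) * (x + t)⁻¹ := by
  intro x hx
  have : (0 : ℝ) < x := hx
  positivity

lemma integrableOn_weight (ht : 0 < t) :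
    IntegrableOn (fun x : ℝ => x ^ (-(1 / 2) : ℝ) * (x + t)⁻¹) (Ioi 0) :=
  integrableOn_Ioi_deriv_of_nonneg continuousWithinAt_arctan_sqrt
    (fun _ hx => hasDerivAt_arctan_sqrt ht hx) (weight_nonneg ht) (tendsto_arctan_sqrt ht)

lemma integral_weight (ht : 0 < t) :
    ∫ x in Ioi (0 : ℝ), x ^ (-(1 / 2) : ℝ) * (x + t)⁻¹ = Real.pi * (√t)⁻¹ := by
  rw [integral_Ioi_of_hasDerivAt_of_nonneg continuousWithinAt_arctan_sqrt
    (fun _ hx => hasDerivAt_arctan_sqrt ht hx) (weight_nonneg ht) (tendsto_arctan_sqrt ht)]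
  simp

variable {V : Type*} [NormedAddCommGroup V]

lemma integrableOn_of_norm_le_weight (ht : 0 < t) {f : ℝ → V} {C : ℝ}
    (hf : ContinuousOn f (Ioi 0))
    (hb : ∀ x ∈ Ioi (0 : ℝ), ‖f x‖ ≤ C * (x ^ (-(1 / 2) : ℝ) * (x + t)⁻¹)) :
    IntegrableOn f (Ioi 0) :=
  ((integrableOn_weight ht).const_mul C).mono' (hf.aestronglyMeasurable measurableSet_Ioi)
    ((ae_restrict_iff' measurableSet_Ioi).2 (ae_of_all _ hb))

lemma norm_integral_le_of_norm_le_weight [NormedSpace ℝ V] (ht : 0 < t) {f : ℝ → V} {C : ℝ}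
    (hb : ∀ x ∈ Ioi (0 : ℝ), ‖f x‖ ≤ C * (x ^ (-(1 / 2) : ℝ) * (x + t)⁻¹)) :
    ‖Real.pi⁻¹ • ∫ x in Ioi (0 : ℝ), f x‖ ≤ C * (√t)⁻¹ := by
  have h := norm_integral_le_of_norm_le ((integrableOn_weight ht).const_mul C)
    ((ae_restrict_iff' measurableSet_Ioi).2 (ae_of_all _ hb))
  rw [integral_const_mul, integral_weight ht] at h
  rw [norm_smul, Real.norm_of_nonneg (inv_nonneg.2 Real.pi_pos.le)]
  calc _ ≤ Real.pi⁻¹ * (C * (Real.pi * (√t)⁻¹)) := by gcongr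
    _ = _ := by field_simp

end Weight

/-! ### Square roots of pseudo-resolvents in a Banach algebra -/

/-- A family in a Banach algebra that behaves like `t ↦ (D + t)⁻¹`, `t > 0`, for an m-accretive `D`:
it satisfies the first resolvent equation and `‖r t‖ ≤ 1 / t`. -/
structure IsPseudoResolvent {𝒜 : Type*} [NormedRing 𝒜] [NormedAlgebra ℝ 𝒜] (r : ℝ → 𝒜) : Prop where
  sub_eq : ∀ s t, 0 < s → 0 < t → r s - r t = (t - s) • (r s * r t)
  norm_le : ∀ t, 0 < t → ‖r t‖ ≤ t⁻¹

/-- The element `(1/π) ∫₀^∞ x ^ (-1/2) r (x + t) dx`, which plays the role of `(D + t)^{-1/2}`. -/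
def resolventSqrt {𝒜 : Type*} [NormedRing 𝒜] [NormedAlgebra ℝ 𝒜] (r : ℝ → 𝒜) (t : ℝ) : 𝒜 :=
  Real.pi⁻¹ • ∫ x in Ioi (0 : ℝ), x ^ (-(1 / 2) : ℝ) • r (x + t)

/-- The element `(1/π) ∫₀^∞ x ^ (1/2) (b - a) r (x + a) r (x + b) dx`, which plays the role of the
bounded difference `(D + b)^{1/2} - (D + a)^{1/2}`. -/
def sqrtDiff {𝒜 : Type*} [NormedRing 𝒜] [NormedAlgebra ℝ 𝒜] (r : ℝ → 𝒜) (a b : ℝ) : 𝒜 :=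
  Real.pi⁻¹ • ∫ x in Ioi (0 : ℝ), (x ^ (-(1 / 2) : ℝ) * x * (b - a)) • (r (x + a) * r (x + b))

namespace IsPseudoResolvent

variable {𝒜 : Type*} [NormedRing 𝒜] [NormedAlgebra ℝ 𝒜] {r : ℝ → 𝒜}

lemma comm (hr : IsPseudoResolvent r) {s t : ℝ} (hs : 0 < s) (ht : 0 < t) :
    r s * r t = r t * r s := by
  rcases eq_or_ne s t with rfl | hne
  · rfl
  have h1 := hr.sub_eq s t hs ht
  have h2 := hr.sub_eq t s ht hs
  have h3 : (t - s) • (r s * r t - r t * r s) = 0 := by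
    rw [smul_sub, ← h1, show t - s = -(s - t) by ring, neg_smul, ← h2]
    abel
  exact sub_eq_zero.1 ((smul_eq_zero.1 h3).resolve_left (sub_ne_zero.2 hne.symm))

lemma norm_le_of_le (hr : IsPseudoResolvent r) {s t : ℝ} (hs : 0 < s) (hst : s ≤ t) :
    ‖r t‖ ≤ s⁻¹ :=
  (hr.norm_le t (hs.trans_le hst)).trans (inv_anti₀ hs hst)

lemma continuousAt (hr : IsPseudoResolvent r) {t : ℝ} (ht : 0 < t) : ContinuousAt r t := by
  have h0 : Tendsto (fun s => |t - s| * ((t / 2)⁻¹ * t⁻¹)) (𝓝 t) (𝓝 0) := by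
    have : Continuous (fun s : ℝ => |t - s| * ((t / 2)⁻¹ * t⁻¹)) := by fun_prop
    simpa using this.tendsto t
  refine tendsto_iff_norm_sub_tendsto_zero.2 (squeeze_zero' (.of_forall fun _ => norm_nonneg _)
    ?_ h0)
  filter_upwards [lt_mem_nhds (show t / 2 < t by linarith)] with s hs
  have hs0 : 0 < s := by linarith
  rw [hr.sub_eq s t hs0 ht, norm_smul, Real.norm_eq_abs]
  gcongr
  exact (norm_mul_le _ _).trans (mul_le_mul (hr.norm_le_of_le (by linarith) hs.le)
    (hr.norm_le t ht) (norm_nonneg _) (by positivity))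

lemma continuousOn_add (hr : IsPseudoResolvent r) {t : ℝ} (ht : 0 ≤ t) :
    ContinuousOn (fun x => r (x + t)) (Ioi 0) := fun x hx =>
  (ContinuousAt.comp (f := fun x => x + t)
    (hr.continuousAt (add_pos_of_pos_of_nonneg hx ht)) (by fun_prop)).continuousWithinAt

lemma hasDerivAt (hr : IsPseudoResolvent r) {t : ℝ} (ht : 0 < t) :
    HasDerivAt r (-(r t * r t)) t := by
  rw [hasDerivAt_iff_tendsto_slope]
  have h1 : Tendsto (fun s => -(r s * r t)) (𝓝[≠] t) (𝓝 (-(r t * r t))) :=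
    (((hr.continuousAt ht).tendsto.mul_const _).neg).mono_left nhdsWithin_le_nhds
  refine h1.congr' ?_
  filter_upwards [self_mem_nhdsWithin, nhdsWithin_le_nhds (lt_mem_nhds ht)] with s hs hs0
  rw [slope_def_module, hr.sub_eq s t hs0 ht, smul_smul, show t - s = -(s - t) by ring, mul_neg,
    inv_mul_cancel₀ (sub_ne_zero.2 hs), neg_one_smul]

lemma hasDerivAt_add (hr : IsPseudoResolvent r) {x t : ℝ} (h : 0 < x + t) :
    HasDerivAt (fun y => r (y + t)) (-(r (x + t) * r (x + t))) x := by
  simpa using (hr.hasDerivAt h).comp_add_const x t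

lemma integrand_norm_le (hr : IsPseudoResolvent r) {t : ℝ} (ht : 0 ≤ t) :
    ∀ x ∈ Ioi (0 : ℝ), ‖x ^ (-(1 / 2) : ℝ) • r (x + t)‖ ≤
      1 * (x ^ (-(1 / 2) : ℝ) * (x + t)⁻¹) := by
  intro x hx
  have hx0 : (0 : ℝ) < x := hx
  rw [norm_smul, Real.norm_of_nonneg (by positivity), one_mul]
  gcongr
  exact hr.norm_le _ (by positivity)

lemma continuousOn_integrand (hr : IsPseudoResolvent r) {t : ℝ} (ht : 0 ≤ t) :
    ContinuousOn (fun x : ℝ => x ^ (-(1 / 2) : ℝ) • r (x + t)) (Ioi 0) :=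
  continuousOn_rpow_weight.smul (hr.continuousOn_add ht)

lemma integrableOn (hr : IsPseudoResolvent r) {t : ℝ} (ht : 0 < t) :
    IntegrableOn (fun x : ℝ => x ^ (-(1 / 2) : ℝ) • r (x + t)) (Ioi 0) :=
  integrableOn_of_norm_le_weight ht (hr.continuousOn_integrand ht.le) (hr.integrand_norm_le ht.le)

lemma norm_resolventSqrt_le (hr : IsPseudoResolvent r) {t : ℝ} (ht : 0 < t) :
    ‖resolventSqrt r t‖ ≤ (√t)⁻¹ :=
  (norm_integral_le_of_norm_le_weight ht (hr.integrand_norm_le ht.le)).trans_eq (one_mul _)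

lemma sq_norm_le (hr : IsPseudoResolvent r) {s t x : ℝ} (hs : 0 < s) (hst : s ≤ t) (hx : 0 < x) :
    ‖x ^ (-(1 / 2) : ℝ) • -(r (x + t) * r (x + t))‖ ≤
      s⁻¹ * (x ^ (-(1 / 2) : ℝ) * (x + s)⁻¹) := by
  rw [norm_smul, Real.norm_of_nonneg (by positivity), norm_neg]
  have h1 : ‖r (x + t)‖ ≤ (x + s)⁻¹ := hr.norm_le_of_le (by linarith) (by linarith)
  have h2 : ‖r (x + t)‖ ≤ s⁻¹ := hr.norm_le_of_le hs (by linarith)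
  calc _ ≤ x ^ (-(1 / 2) : ℝ) * (s⁻¹ * (x + s)⁻¹) := by
        gcongr
        exact (norm_mul_le _ _).trans (mul_le_mul h2 h1 (norm_nonneg _) (by positivity))
    _ = _ := by ring

lemma continuousOn_sq (hr : IsPseudoResolvent r) {t : ℝ} (ht : 0 ≤ t) :
    ContinuousOn (fun x : ℝ => x ^ (-(1 / 2) : ℝ) • -(r (x + t) * r (x + t))) (Ioi 0) :=
  continuousOn_rpow_weight.smul ((hr.continuousOn_add ht).mul (hr.continuousOn_add ht)).neg

lemma sqrtDiff_integrand_norm_le (hr : IsPseudoResolvent r) {a b : ℝ} (ha : 0 ≤ a) (hab : a ≤ b) :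
    ∀ x ∈ Ioi (0 : ℝ), ‖(x ^ (-(1 / 2) : ℝ) * x * (b - a)) • (r (x + a) * r (x + b))‖ ≤
      (b - a) * (x ^ (-(1 / 2) : ℝ) * (x + b)⁻¹) := by
  intro x hx
  have hx0 : (0 : ℝ) < x := hx
  have hba : 0 ≤ b - a := sub_nonneg.2 hab
  rw [norm_smul, Real.norm_of_nonneg (by positivity)]
  have h1 : ‖r (x + a)‖ ≤ x⁻¹ := hr.norm_le_of_le hx0 (by linarith)
  have h2 : ‖r (x + b)‖ ≤ (x + b)⁻¹ := hr.norm_le _ (by linarith)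
  calc _ ≤ x ^ (-(1 / 2) : ℝ) * x * (b - a) * (x⁻¹ * (x + b)⁻¹) := by
        gcongr
        exact (norm_mul_le _ _).trans (mul_le_mul h1 h2 (norm_nonneg _) (by positivity))
    _ = _ := by field_simp

lemma integrableOn_sqrtDiff (hr : IsPseudoResolvent r) {a b : ℝ} (ha : 0 ≤ a) (hab : a ≤ b)
    (hb : 0 < b) : IntegrableOn
      (fun x : ℝ => (x ^ (-(1 / 2) : ℝ) * x * (b - a)) • (r (x + a) * r (x + b))) (Ioi 0) :=
  integrableOn_of_norm_le_weight hb
    (((continuousOn_rpow_weight.mul continuousOn_id).mul continuousOn_const).smul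
      ((hr.continuousOn_add ha).mul (hr.continuousOn_add hb.le)))
    (hr.sqrtDiff_integrand_norm_le ha hab)

lemma norm_sqrtDiff_le (hr : IsPseudoResolvent r) {a b : ℝ} (ha : 0 ≤ a) (hab : a ≤ b)
    (hb : 0 < b) : ‖sqrtDiff r a b‖ ≤ (b - a) * (√b)⁻¹ :=
  norm_integral_le_of_norm_le_weight hb (hr.sqrtDiff_integrand_norm_le ha hab)

lemma norm_one_sub_sqrtDiff_mul_le (hr : IsPseudoResolvent r) {a b : ℝ} (ha : 0 < a) (hab : a ≤ b)
    (h1 : ‖(1 : 𝒜)‖ ≤ 1) : ‖1 - sqrtDiff r a b * resolventSqrt r b‖ ≤ 2 := by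
  have hb : 0 < b := ha.trans_le hab
  have hs := Real.sqrt_pos.2 hb
  have h2 : ‖sqrtDiff r a b * resolventSqrt r b‖ ≤ 1 :=
    calc _ ≤ (b - a) * (√b)⁻¹ * (√b)⁻¹ := by
          refine (norm_mul_le _ _).trans (mul_le_mul (hr.norm_sqrtDiff_le ha.le hab hb)
            (hr.norm_resolventSqrt_le hb) (norm_nonneg _) ?_)
          have := sub_nonneg.2 hab
          positivity
      _ = (b - a) / b := by
          rw [mul_assoc, ← mul_inv, Real.mul_self_sqrt hb.le, div_eq_mul_inv]
      _ ≤ 1 := by rw [div_le_one hb]; linarith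
  calc _ ≤ ‖(1 : 𝒜)‖ + ‖sqrtDiff r a b * resolventSqrt r b‖ := norm_sub_le _ _
    _ ≤ 2 := by linarith

lemma comm_resolventSqrt (hr : IsPseudoResolvent r) {s t : ℝ} (hs : 0 < s) (ht : 0 < t) :
    r s * resolventSqrt r t = resolventSqrt r t * r s := by
  have hi := hr.integrableOn ht
  rw [resolventSqrt, mul_smul_comm, smul_mul_assoc, ← integral_const_mul_of_integrable hi,
    ← integral_mul_const_of_integrable hi]
  congr 1
  refine setIntegral_congr_fun measurableSet_Ioi fun x hx => ?_
  rw [mul_smul_comm, smul_mul_assoc, hr.comm hs (add_pos hx ht)]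

/-- An integration by parts: `∫ x ^ (-1/2) r (x + t) ^ 2 = (1/2) r t ∫ x ^ (-1/2) r (x + t)`. -/
lemma integral_sq [CompleteSpace 𝒜] (hr : IsPseudoResolvent r) {t : ℝ} (ht : 0 < t) :
    ∫ x in Ioi (0 : ℝ), x ^ (-(1 / 2) : ℝ) • -(r (x + t) * r (x + t)) =
      -((1 / 2 : ℝ) • (r t * ∫ x in Ioi (0 : ℝ), x ^ (-(1 / 2) : ℝ) • r (x + t))) := by
  have hi1 := hr.integrableOn ht
  have hi2 := integrableOn_of_norm_le_weight ht (hr.continuousOn_sq ht.le)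
    (fun x hx => hr.sq_norm_le ht le_rfl hx)
  set f' : ℝ → 𝒜 := fun x => (1 / 2 : ℝ) • (x ^ (-(1 / 2) : ℝ) • r (x + t)) +
    x • (x ^ (-(1 / 2) : ℝ) • -(r (x + t) * r (x + t))) with hf'
  have hi3 : IntegrableOn (fun x : ℝ => x • (x ^ (-(1 / 2) : ℝ) • -(r (x + t) * r (x + t))))
      (Ioi 0) := by
    refine integrableOn_of_norm_le_weight (C := 1) ht
      (continuousOn_id.smul (hr.continuousOn_sq ht.le)) fun x hx => ?_
    have hx0 : (0 : ℝ) < x := hx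
    rw [norm_smul, norm_smul, Real.norm_of_nonneg hx0.le, Real.norm_of_nonneg (by positivity),
      norm_neg]
    have h1 : ‖r (x + t)‖ ≤ (x + t)⁻¹ := hr.norm_le _ (by linarith)
    have h2 : ‖r (x + t)‖ ≤ x⁻¹ := hr.norm_le_of_le hx0 (by linarith)
    calc _ ≤ x * (x ^ (-(1 / 2) : ℝ) * (x⁻¹ * (x + t)⁻¹)) := by
          gcongr
          exact (norm_mul_le _ _).trans (mul_le_mul h2 h1 (norm_nonneg _) (by positivity))
      _ = _ := by field_simp
  have hint : ∫ x in Ioi (0 : ℝ), f' x = 0 := by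
    have hcont : ContinuousWithinAt (fun x => √x • r (x + t)) (Ici 0) 0 := by
      refine ContinuousAt.continuousWithinAt (ContinuousAt.smul (by fun_prop) ?_)
      exact ContinuousAt.comp (f := fun x => x + t)
        (hr.continuousAt (by simpa using ht)) (by fun_prop)
    have hderiv : ∀ x ∈ Ioi (0 : ℝ), HasDerivAt (fun x => √x • r (x + t)) (f' x) x := by
      intro x hx
      have hx0 : (0 : ℝ) < x := hx
      have h := (Real.hasDerivAt_sqrt hx0.ne').smul (hr.hasDerivAt_add (x := x) (t := t)
        (by linarith))
      convert! h using 1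
      rw [hf']
      dsimp only
      rw [rpow_weight_eq hx0, smul_smul, smul_smul, add_comm]
      have hs := Real.sqrt_pos.2 hx0
      congr 2
      · nth_rewrite 1 [← Real.mul_self_sqrt hx0.le]
        field_simp
      · field_simp
    have hlim : Tendsto (fun x => √x • r (x + t)) atTop (𝓝 0) := by
      have h1 : Tendsto (fun x : ℝ => (√x)⁻¹) atTop (𝓝 0) :=
        tendsto_inv_atTop_zero.comp Real.tendsto_sqrt_atTop
      refine squeeze_zero_norm' ?_ h1
      filter_upwards [eventually_gt_atTop 0] with x hx0
      rw [norm_smul, Real.norm_of_nonneg (Real.sqrt_nonneg x)]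
      have h2 : ‖r (x + t)‖ ≤ x⁻¹ := hr.norm_le_of_le hx0 (by linarith)
      have hs := Real.sqrt_pos.2 hx0
      calc _ ≤ √x * x⁻¹ := by gcongr
        _ = _ := by
          nth_rewrite 2 [← Real.mul_self_sqrt hx0.le]
          field_simp
    rw [integral_Ioi_of_hasDerivAt_of_tendsto hcont hderiv ((hi1.smul (1 / 2 : ℝ)).add hi3) hlim]
    simp
  have hkey : ∀ x ∈ Ioi (0 : ℝ), x ^ (-(1 / 2) : ℝ) • -(r (x + t) * r (x + t)) =
      -((1 / 2 : ℝ) • (r t * (x ^ (-(1 / 2) : ℝ) • r (x + t)))) - r t * f' x := by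
    intro x hx
    have hx0 : (0 : ℝ) < x := hx
    have h1 : x • (r t * (r (x + t) * r (x + t))) =
        r t * r (x + t) - r (x + t) * r (x + t) := by
      have := hr.sub_eq t (x + t) ht (by linarith)
      rw [← sub_mul, this, add_sub_cancel_right, smul_mul_assoc, mul_assoc]
    have h2 : r t * f' x = (1 / 2 : ℝ) • (r t * (x ^ (-(1 / 2) : ℝ) • r (x + t))) -
        x ^ (-(1 / 2) : ℝ) • (r t * r (x + t) - r (x + t) * r (x + t)) := by
      rw [hf', ← h1]
      simp only [mul_add, mul_smul_comm, mul_neg, smul_neg]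
      rw [smul_comm x, sub_eq_add_neg]
    rw [h2, mul_smul_comm]
    module
  have hf'i : IntegrableOn f' (Ioi 0) := (hi1.smul (1 / 2 : ℝ)).add hi3
  have hi4 : IntegrableOn (fun x : ℝ => (1 / 2 : ℝ) • (r t * (x ^ (-(1 / 2) : ℝ) • r (x + t))))
      (Ioi 0) := (hi1.const_mul (r t)).smul (1 / 2 : ℝ)
  have hi5 : IntegrableOn (fun x : ℝ => -((1 / 2 : ℝ) • (r t * (x ^ (-(1 / 2) : ℝ) • r (x + t)))))
      (Ioi 0) := hi4.neg
  rw [setIntegral_congr_fun measurableSet_Ioi hkey, integral_sub hi5 (hf'i.const_mul _),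
    integral_neg, integral_smul, integral_const_mul_of_integrable hi1,
    integral_const_mul_of_integrable hf'i, hint, mul_zero, sub_zero]

lemma hasDerivAt_resolventSqrt [CompleteSpace 𝒜] (hr : IsPseudoResolvent r) {t : ℝ} (ht : 0 < t) :
    HasDerivAt (resolventSqrt r) (-((1 / 2 : ℝ) • (r t * resolventSqrt r t))) t := by
  have h := (hasDerivAt_integral_of_dominated_loc_of_deriv_le
    (μ := volume.restrict (Ioi (0 : ℝ))) (x₀ := t) (s := Ioi (t / 2))
    (F := fun s x => x ^ (-(1 / 2) : ℝ) • r (x + s))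
    (F' := fun s x => x ^ (-(1 / 2) : ℝ) • -(r (x + s) * r (x + s)))
    (bound := fun x => (t / 2)⁻¹ * (x ^ (-(1 / 2) : ℝ) * (x + t / 2)⁻¹))
    (Ioi_mem_nhds (by linarith))
    (by
      filter_upwards [lt_mem_nhds ht] with s hs
      exact (hr.continuousOn_integrand hs.le).aestronglyMeasurable measurableSet_Ioi)
    (hr.integrableOn ht) ((hr.continuousOn_sq ht.le).aestronglyMeasurable measurableSet_Ioi)
    ((ae_restrict_iff' measurableSet_Ioi).2 (ae_of_all _ fun x hx s hs =>
      hr.sq_norm_le (by linarith) (le_of_lt hs) hx))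
    ((integrableOn_weight (by linarith)).const_mul _)
    ((ae_restrict_iff' measurableSet_Ioi).2 (ae_of_all _ fun x hx s hs => by
      have hx0 : (0 : ℝ) < x := hx
      have hs0 : t / 2 < s := hs
      have h := ((hr.hasDerivAt_add (x := s) (t := x) (by linarith)).const_smul
        (x ^ (-(1 / 2) : ℝ)))
      rw [add_comm s x] at h
      exact h.congr_of_eventuallyEq (.of_forall fun y => by simp [add_comm y x])))).2
  have h2 := h.const_smul Real.pi⁻¹
  rw [hr.integral_sq ht] at h2
  convert! h2 using 1
  rw [resolventSqrt, smul_neg, smul_comm, mul_smul_comm]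

/-- Formally `√t (D + t)^{-1/2} → 1` as `t → ∞`, here multiplied by `r s` in order to have norm
convergence (with rate `1 / t`). -/
lemma tendsto_sqrt_smul_resolventSqrt [CompleteSpace 𝒜] (hr : IsPseudoResolvent r) {s : ℝ}
    (hs : 0 < s) : Tendsto (fun t => √t • (resolventSqrt r t * r s)) atTop (𝓝 (r s)) := by
  set C : ℝ := 1 + s * s⁻¹
  -- `‖t r(t) r(s) - r(s)‖ ≤ C / t`
  have hC : ∀ t, 0 < t → ‖r t * r s - t⁻¹ • r s‖ ≤ C * t⁻¹ * t⁻¹ := by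
    intro t ht
    have h1 : r t * r s - t⁻¹ • r s = t⁻¹ • (-r t + s • (r t * r s)) := by
      have h2 := hr.sub_eq t s ht hs
      have h3 : t • (r t * r s) - r s = -r t + s • (r t * r s) := by
        have : t • (r t * r s) = s • (r t * r s) - (s - t) • (r t * r s) := by module
        rw [this, ← h2]
        abel
      rw [← h3, smul_sub, smul_smul, inv_mul_cancel₀ ht.ne', one_smul]
    rw [h1, norm_smul, Real.norm_of_nonneg (by positivity)]
    have h4 : ‖-r t + s • (r t * r s)‖ ≤ t⁻¹ + s * (t⁻¹ * s⁻¹) := by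
      refine (norm_add_le _ _).trans ?_
      rw [norm_neg, norm_smul, Real.norm_of_nonneg hs.le]
      gcongr
      · exact hr.norm_le t ht
      · exact (norm_mul_le _ _).trans (mul_le_mul (hr.norm_le t ht) (hr.norm_le s hs)
          (norm_nonneg _) (by positivity))
    calc _ ≤ t⁻¹ * (t⁻¹ + s * (t⁻¹ * s⁻¹)) := by gcongr
      _ = _ := by ring
  have hmain : ∀ t, 0 < t → ‖√t • (resolventSqrt r t * r s) - r s‖ ≤ C * t⁻¹ := by
    intro t ht
    have hst := Real.sqrt_pos.2 ht
    have hi := hr.integrableOn ht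
    have hiw := integrableOn_weight ht
    have e1 : √t • (resolventSqrt r t * r s) - r s = √t • (Real.pi⁻¹ • ∫ x in Ioi (0 : ℝ),
        (x ^ (-(1 / 2) : ℝ) • r (x + t) * r s - (x ^ (-(1 / 2) : ℝ) * (x + t)⁻¹) • r s)) := by
      rw [integral_sub (hi.mul_const _) (hiw.smul_const _), integral_mul_const_of_integrable hi,
        integral_smul_const, integral_weight ht, smul_sub, smul_sub, smul_smul Real.pi⁻¹,
        resolventSqrt, smul_mul_assoc]
      congr 1
      rw [smul_smul, inv_mul_cancel_left₀ Real.pi_ne_zero, mul_inv_cancel₀ hst.ne', one_smul]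
    rw [e1, norm_smul, Real.norm_of_nonneg hst.le]
    have := norm_integral_le_of_norm_le_weight (C := C * t⁻¹) ht (f := fun x : ℝ =>
      x ^ (-(1 / 2) : ℝ) • r (x + t) * r s - (x ^ (-(1 / 2) : ℝ) * (x + t)⁻¹) • r s) (by
        intro x hx
        have hx0 : (0 : ℝ) < x := hx
        rw [mul_smul, smul_mul_assoc, ← smul_sub, norm_smul, Real.norm_of_nonneg (by positivity)]
        calc _ ≤ x ^ (-(1 / 2) : ℝ) * (C * (x + t)⁻¹ * (x + t)⁻¹) := by
              gcongr
              exact hC _ (by positivity)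
          _ ≤ x ^ (-(1 / 2) : ℝ) * (C * t⁻¹ * (x + t)⁻¹) := by
              have hC0 : 0 ≤ C := by positivity
              gcongr
              linarith
          _ = _ := by ring)
    calc _ ≤ √t * (C * t⁻¹ * (√t)⁻¹) := by gcongr
      _ = _ := by field_simp
  refine tendsto_iff_norm_sub_tendsto_zero.2 (squeeze_zero_norm' (a := fun t => C * t⁻¹) ?_ ?_)
  · filter_upwards [eventually_gt_atTop 0] with t ht
    exact (norm_norm _).trans_le (hmain t ht)
  · simpa using tendsto_inv_atTop_zero.const_mul C

/-- `resolventSqrt r s` is a square root of `r s`: for fixed `s`, the function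
`t ↦ resolventSqrt r t ^ 2 (1 + (t - s) r s)`, formally `(D + t)⁻¹ (D + t) (D + s)⁻¹`, is constant
on `(0, ∞)`. Its value at `t = s` is the square, its limit at infinity is `r s`. -/
theorem resolventSqrt_mul_self [CompleteSpace 𝒜] (hr : IsPseudoResolvent r) {s : ℝ} (hs : 0 < s) :
    resolventSqrt r s * resolventSqrt r s = r s := by
  set S := resolventSqrt r
  set w : ℝ → 𝒜 := fun t => S t * S t * (1 + (t - s) • r s) with hw
  have hd : ∀ t ∈ Ioi (0 : ℝ), HasDerivAt w 0 t := by
    intro t ht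
    have ht0 : (0 : ℝ) < t := ht
    have h1 := hr.hasDerivAt_resolventSqrt ht0
    have h2 : HasDerivAt (fun t : ℝ => 1 + (t - s) • r s) (r s) t := by
      simpa using (((hasDerivAt_id t).sub_const s).smul_const (r s)).const_add 1
    have h3 := (h1.mul h1).mul h2
    convert! h3 using 1
    change (0 : 𝒜) = (-((1 / 2 : ℝ) • (r t * S t)) * S t + S t * -((1 / 2 : ℝ) • (r t * S t))) *
      (1 + (t - s) • r s) + S t * S t * r s
    have c1 : S t * (r t * S t) = r t * S t * S t := by
      rw [hr.comm_resolventSqrt ht0 ht0, mul_assoc, hr.comm_resolventSqrt ht0 ht0]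
    have c2 : S t * S t * r s = S t * S t * (r t + (t - s) • (r t * r s)) := by
      congr 1
      have := hr.sub_eq t s ht0 hs
      rw [← neg_sub s t, neg_smul, ← this]
      abel
    rw [mul_neg, neg_mul, mul_smul_comm, smul_mul_assoc, c1, mul_assoc (r t),
      show -((1 / 2 : ℝ) • (r t * (S t * S t))) + -((1 / 2 : ℝ) • (r t * (S t * S t)))
        = -(r t * (S t * S t)) by module, c2]
    have c3 : r t * (S t * S t) = S t * S t * r t := by
      rw [← mul_assoc, ← c1, mul_assoc, ← hr.comm_resolventSqrt ht0 ht0]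
    rw [c3]
    simp only [mul_add, neg_mul, mul_one, mul_smul_comm, mul_assoc]
    module
  have hconst : ∀ t ∈ Ioi (0 : ℝ), w t = w s := by
    intro t ht
    exact (convex_Ioi (0 : ℝ)).is_const_of_fderivWithin_eq_zero (𝕜 := ℝ)
      (fun x hx => (hd x hx).differentiableAt.differentiableWithinAt)
      (fun x hx => by
        have := (hd x hx).hasDerivWithinAt (s := Ioi (0 : ℝ)) |>.hasFDerivWithinAt
        rw [this.fderivWithin (isOpen_Ioi.uniqueDiffWithinAt hx)]
        ext; simp) ht hs
  have hS0 : Tendsto S atTop (𝓝 0) := by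
    refine squeeze_zero_norm' ?_ (tendsto_inv_atTop_zero.comp Real.tendsto_sqrt_atTop)
    filter_upwards [eventually_gt_atTop 0] with t ht using hr.norm_resolventSqrt_le ht
  have hlim : Tendsto w atTop (𝓝 (r s)) := by
    have e : ∀ᶠ t in atTop, S t * S t * (1 - s • r s) + √t • (S t * (√t • (S t * r s))) = w t := by
      filter_upwards [eventually_gt_atTop 0] with t ht
      rw [hw, mul_smul_comm, smul_smul, Real.mul_self_sqrt ht.le]
      simp only [mul_add, mul_sub, mul_one, mul_smul_comm, mul_assoc, sub_smul]
      abel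
    refine Tendsto.congr' e ?_
    have h1 : Tendsto (fun t => S t * S t * (1 - s • r s)) atTop (𝓝 0) := by
      simpa using (hS0.mul hS0).mul_const (1 - s • r s)
    have h2 := hr.tendsto_sqrt_smul_resolventSqrt hs
    have h3 : Tendsto (fun t => √t • (S t * (√t • (S t * r s) - r s))) atTop (𝓝 0) := by
      have h4 : Tendsto (fun t => ‖√t • (S t * r s) - r s‖) atTop (𝓝 0) :=
        tendsto_iff_norm_sub_tendsto_zero.1 h2
      refine squeeze_zero_norm' ?_ h4
      filter_upwards [eventually_gt_atTop 0] with t ht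
      have hst := Real.sqrt_pos.2 ht
      rw [norm_smul, Real.norm_of_nonneg hst.le]
      calc _ ≤ √t * ((√t)⁻¹ * ‖√t • (S t * r s) - r s‖) := by
            gcongr
            refine (norm_mul_le _ _).trans ?_
            gcongr
            exact hr.norm_resolventSqrt_le ht
        _ = _ := by field_simp
    have h5 := (h1.add h3).add h2
    simp only [zero_add] at h5
    refine h5.congr fun t => ?_
    change S t * S t * (1 - s • r s) + √t • (S t * (√t • (S t * r s) - r s)) +
      √t • (S t * r s) = _
    rw [mul_sub (S t), smul_sub]
    abel
  have hfin : Tendsto w atTop (𝓝 (w s)) :=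
    tendsto_const_nhds.congr' (by
      filter_upwards [eventually_gt_atTop 0] with t ht using (hconst t ht).symm)
  have := tendsto_nhds_unique hfin hlim
  simpa [hw] using this

lemma comm_sqrtDiff (hr : IsPseudoResolvent r) {a b s : ℝ} (ha : 0 ≤ a) (hab : a ≤ b)
    (hb : 0 < b) (hs : 0 < s) : r s * sqrtDiff r a b = sqrtDiff r a b * r s := by
  have hi := hr.integrableOn_sqrtDiff ha hab hb
  rw [sqrtDiff, mul_smul_comm, smul_mul_assoc, ← integral_const_mul_of_integrable hi,
    ← integral_mul_const_of_integrable hi]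
  congr 1
  refine setIntegral_congr_fun measurableSet_Ioi fun x hx => ?_
  have hx0 : (0 : ℝ) < x := hx
  have ha' : 0 < x + a := by linarith
  have hb' : 0 < x + b := by linarith
  have e : r s * (r (x + a) * r (x + b)) = r (x + a) * r (x + b) * r s := by
    rw [← mul_assoc, hr.comm hs ha', mul_assoc, hr.comm hs hb', mul_assoc]
  rw [mul_smul_comm, smul_mul_assoc, e]

/-- The relation `((D + b)^{1/2} - (D + a)^{1/2}) (D + b)⁻¹ = (D + b)^{-1/2} - (D + a)^{1/2}
(D + b)⁻¹`, where `(D + a) (D + b)⁻¹ = 1 + (a - b) (D + b)⁻¹`. -/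
lemma sqrtDiff_mul (hr : IsPseudoResolvent r) {a b : ℝ} (ha : 0 < a) (hab : a ≤ b) :
    sqrtDiff r a b * r b = resolventSqrt r b - resolventSqrt r a * (1 + (a - b) • r b) := by
  have hb : 0 < b := ha.trans_le hab
  have hi := hr.integrableOn_sqrtDiff ha.le hab hb
  have hia := hr.integrableOn ha
  have hib := hr.integrableOn hb
  rw [sqrtDiff, resolventSqrt, resolventSqrt, smul_mul_assoc, smul_mul_assoc, ← smul_sub,
    ← integral_mul_const_of_integrable hi, ← integral_mul_const_of_integrable hia,
    ← integral_sub hib (hia.mul_const _)]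
  congr 1
  refine setIntegral_congr_fun measurableSet_Ioi fun x hx => ?_
  have hx0 : (0 : ℝ) < x := hx
  have h1 : (b - a) • (r (x + a) * r (x + b)) = r (x + a) - r (x + b) := by
    rw [hr.sub_eq (x + a) (x + b) (by linarith) (by linarith)]
    congr 1; ring
  have h2 : x • (r (x + b) * r b) = r b - r (x + b) := by
    rw [hr.sub_eq b (x + b) hb (by linarith), hr.comm hb (by linarith : 0 < x + b)]
    congr 1; ring
  have h3 : x • (r (x + a) * r b) = r b - r (x + a) - (a - b) • (r (x + a) * r b) := by
    rw [hr.sub_eq b (x + a) hb (by linarith), hr.comm hb (by linarith : 0 < x + a)]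
    module
  have h4 : x • ((r (x + a) - r (x + b)) * r b) =
      r (x + b) - r (x + a) * (1 + (a - b) • r b) := by
    rw [sub_mul, smul_sub, h2, h3, mul_add, mul_one, mul_smul_comm]
    abel
  rw [mul_smul, h1, mul_smul, smul_mul_assoc, smul_mul_assoc, h4, smul_sub, smul_mul_assoc]

/-- Formally
`(D + a)^{-1/2} - (D + b)^{-1/2} = (D + a)^{-1/2} ((D + b)^{1/2} - (D + a)^{1/2}) (D + b)^{-1/2}`,
for an injective pseudo-resolvent. -/
lemma resolventSqrt_sub [CompleteSpace 𝒜] (hr : IsPseudoResolvent r) {a b : ℝ}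
    (ha : 0 < a) (hab : a ≤ b) (hinj : IsLeftRegular (r b)) :
    resolventSqrt r a - resolventSqrt r b =
      resolventSqrt r a * sqrtDiff r a b * resolventSqrt r b := by
  have hb : 0 < b := ha.trans_le hab
  set S := resolventSqrt r
  set W := sqrtDiff r a b
  have h1 : S a * (W * r b) = (S a - S b) * S b := by
    have h2 : r a * (1 + (a - b) • r b) = r b := by
      have := hr.sub_eq a b ha hb
      rw [mul_add, mul_one, mul_smul_comm, ← neg_sub b a, neg_smul, ← this]
      abel
    rw [hr.sqrtDiff_mul ha hab, mul_sub, ← mul_assoc, hr.resolventSqrt_mul_self ha, h2, sub_mul,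
      hr.resolventSqrt_mul_self hb]
  apply hinj
  change r b * (S a - S b) = r b * (S a * W * S b)
  have c1 : r b * (S a * W * S b) = S a * (W * r b) * S b := by
    rw [hr.comm_sqrtDiff ha.le hab hb hb |>.symm]
    simp only [← mul_assoc]
    rw [hr.comm_resolventSqrt hb ha]
  rw [c1, h1, mul_assoc, hr.resolventSqrt_mul_self hb, sub_mul, mul_sub,
    hr.comm_resolventSqrt hb ha, hr.comm_resolventSqrt hb hb]

/-- The factor `1 - sqrtDiff r a b * resolventSqrt r b` plays the role of the bounded operator
`(D + a)^{1/2} (D + b)^{-1/2}`. -/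
lemma resolventSqrt_mul_one_sub [CompleteSpace 𝒜] (hr : IsPseudoResolvent r) {a b : ℝ}
    (ha : 0 < a) (hab : a ≤ b) (hinj : IsLeftRegular (r b)) :
    resolventSqrt r a * (1 - sqrtDiff r a b * resolventSqrt r b) = resolventSqrt r b := by
  rw [mul_sub, mul_one, ← mul_assoc, ← hr.resolventSqrt_sub ha hab hinj]
  abel

end IsPseudoResolvent

/-! ### Resolvents of unbounded operators -/

section Resolvent

variable {E : Type*} [NormedAddCommGroup E] [InnerProductSpace ℂ E]
  {D : E →ₗ.[ℂ] E} {z w : ℂ} {R Q : E →L[ℂ] E}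

lemma IsResolvent.unique (hR : IsResolvent D z R) (hQ : IsResolvent D z Q) : R = Q := by
  ext x
  obtain ⟨h, hx⟩ := hQ.1 x
  have := hR.2 ⟨Q x, h⟩
  rwa [hx] at this

lemma isResolvent_resolvent (hz : z ∈ resolventSet D) : IsResolvent D z (resolvent D z) := by
  rw [resolvent, dif_pos hz]
  exact hz.choose_spec

lemma IsResolvent.resolvent_eq (hR : IsResolvent D z R) : resolvent D z = R :=
  (isResolvent_resolvent ⟨R, hR⟩).unique hR

lemma IsResolvent.mem_domain (hR : IsResolvent D z R) (x : E) : R x ∈ D.domain := (hR.1 x).1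

lemma IsResolvent.apply_eq (hR : IsResolvent D z R) (x : E) :
    D ⟨R x, hR.mem_domain x⟩ = x + z • R x := by
  obtain ⟨h, hx⟩ := hR.1 x
  rw [← sub_eq_iff_eq_add]
  exact hx

lemma IsResolvent.injective (hR : IsResolvent D z R) : Function.Injective R := by
  rw [injective_iff_map_eq_zero]
  intro x hx
  obtain ⟨h, hx'⟩ := hR.1 x
  have h0 : (⟨R x, h⟩ : D.domain) = 0 := Subtype.ext hx
  rw [h0, hx, D.map_zero] at hx'
  simpa using hx'.symm

lemma IsResolvent.mem_domain_iff (hR : IsResolvent D z R) (u : E) :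
    u ∈ D.domain ↔ ∃ x, R x = u :=
  ⟨fun h => ⟨_, hR.2 ⟨u, h⟩⟩, fun ⟨x, hx⟩ => hx ▸ hR.mem_domain x⟩

/-- The first resolvent equation. -/
lemma IsResolvent.sub_eq (hR : IsResolvent D z R) (hQ : IsResolvent D w Q) :
    R - Q = (z - w) • (R * Q) := by
  ext x
  have h := hR.2 ⟨Q x, hQ.mem_domain x⟩
  rw [hQ.apply_eq] at h
  simp only [map_sub, map_add, map_smul] at h
  simp only [sub_apply, smul_apply,
    mul_apply_eq_comp]
  nth_rewrite 1 [← h]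
  module

lemma IsResolvent.addScalar {c : ℂ} (hR : IsResolvent D (z - c) R) :
    IsResolvent (addScalar D c) z R := by
  have happ : ∀ u : D.domain, SqrtDomain.addScalar D c u = D u + c • (u : E) := fun u => rfl
  refine ⟨fun x => ⟨hR.mem_domain x, ?_⟩, fun u => ?_⟩
  · refine (congrArg (· - z • R x) (happ ⟨R x, hR.mem_domain x⟩)).trans ?_
    rw [hR.apply_eq]
    module
  · have h := hR.2 u
    refine Eq.trans ?_ h
    congr 1
    refine (congrArg (· - z • (u : E)) (happ u)).trans ?_
    module

lemma ofBounded_ker (hR : Function.Injective R) : LinearMap.ker (ofBounded R).toFun = ⊥ := by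
  rw [LinearMap.ker_eq_bot']
  intro x hx
  exact Subtype.ext ((injective_iff_map_eq_zero R).1 hR _ hx)

/-- For an injective bounded `R`, the operator `R⁻¹ + z` sends `R x` to `x + z R x`. -/
lemma mem_addScalar_inverse (hR : Function.Injective R) (z : ℂ) (x : E) :
    ∃ h : R x ∈ (addScalar (ofBounded R).inverse z).domain,
      addScalar (ofBounded R).inverse z ⟨R x, h⟩ = x + z • R x := by
  have h : R x ∈ (ofBounded R).inverse.domain := by
    rw [LinearPMap.inverse_domain]
    exact ⟨⟨x, trivial⟩, rfl⟩
  refine ⟨h, ?_⟩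
  have h1 : (ofBounded R).inverse ⟨R x, h⟩ = x :=
    LinearPMap.inverse_apply_eq (ofBounded_ker hR) (x := ⟨x, trivial⟩) rfl
  exact congrArg (· + z • R x) h1

lemma mem_addScalar_inverse_domain {z : ℂ} {u : E}
    (hu : u ∈ (addScalar (ofBounded R).inverse z).domain) : ∃ x, R x = u := by
  change u ∈ (ofBounded R).inverse.domain at hu
  rw [LinearPMap.inverse_domain] at hu
  obtain ⟨x, hx⟩ := hu
  exact ⟨x, hx⟩

/-- If `Q` is related to `R` by the first resolvent equation, then it is the resolvent at `w` of the
operator `R⁻¹ + z`. -/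
lemma isResolvent_addScalar_inverse (hR : Function.Injective R)
    (h1 : R - Q = (z - w) • (R * Q)) (h2 : R - Q = (z - w) • (Q * R)) :
    IsResolvent (addScalar (ofBounded R).inverse z) w Q := by
  have e1 : ∀ x, Q x = R (x - (z - w) • Q x) := by
    intro x
    have := congrArg (fun S : E →L[ℂ] E => S x) h1
    simp only [sub_apply, smul_apply,
      mul_apply_eq_comp] at this
    rw [map_sub, map_smul, ← this]
    abel
  refine ⟨fun x => ?_, fun u => ?_⟩
  · obtain ⟨h, hx⟩ := mem_addScalar_inverse hR z (x - (z - w) • Q x)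
    have h' : Q x ∈ (addScalar (ofBounded R).inverse z).domain := by rw [e1]; exact h
    refine ⟨h', ?_⟩
    have : (⟨Q x, h'⟩ : (addScalar (ofBounded R).inverse z).domain) =
      ⟨R (x - (z - w) • Q x), h⟩ := Subtype.ext (e1 x)
    rw [this, hx, ← e1]
    module
  · obtain ⟨u, hu⟩ := u
    obtain ⟨x, rfl⟩ := mem_addScalar_inverse_domain hu
    obtain ⟨h, hx⟩ := mem_addScalar_inverse hR z x
    rw [hx]
    have := congrArg (fun S : E →L[ℂ] E => S x) h2
    simp only [sub_apply, smul_apply,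
      mul_apply_eq_comp] at this
    have e : x + z • R x - w • R x = x + (z - w) • R x := by module
    rw [e, map_add, map_smul, ← this]
    abel

lemma addScalar_inverse_eq (hR : IsResolvent D z R) :
    addScalar (ofBounded R).inverse z = D := by
  refine LinearPMap.ext (E := E) (F := E) ?_ ?_
  · ext u
    rw [hR.mem_domain_iff]
    refine ⟨mem_addScalar_inverse_domain, ?_⟩
    rintro ⟨x, rfl⟩
    exact (mem_addScalar_inverse hR.injective z x).1
  · intro u hu hu'
    obtain ⟨x, rfl⟩ := mem_addScalar_inverse_domain hu
    obtain ⟨h, hx⟩ := mem_addScalar_inverse hR.injective z x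
    rw [hx, hR.apply_eq]

end Resolvent

/-! ### M-accretive operators and their square roots -/

section Accretive

variable {H : Type*} [NormedAddCommGroup H] [InnerProductSpace ℂ H] {D : H →ₗ.[ℂ] H}

/-- The resolvent `t ↦ (D + t)⁻¹` on the positive half-line. -/
def posResolvent (D : H →ₗ.[ℂ] H) (t : ℝ) : H →L[ℂ] H := resolvent D (-(t : ℂ))

lemma IsMAccretive.isResolvent (hD : IsMAccretive D) {t : ℝ} (ht : 0 < t) :
    IsResolvent D (-(t : ℂ)) (posResolvent D t) :=
  isResolvent_resolvent (hD t (by simpa using ht)).1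

lemma IsMAccretive.isPseudoResolvent (hD : IsMAccretive D) :
    IsPseudoResolvent (posResolvent D) where
  sub_eq s t hs ht := by
    rw [(hD.isResolvent hs).sub_eq (hD.isResolvent ht), ← Complex.coe_smul]
    congr 1
    push_cast
    ring
  norm_le t ht := (hD t (by simpa using ht)).2

lemma IsMAccretive.isLeftRegular (hD : IsMAccretive D) {t : ℝ} (ht : 0 < t) :
    IsLeftRegular (posResolvent D t) := by
  intro X Y h
  ext x
  exact (hD.isResolvent ht).injective (congrArg (fun S : H →L[ℂ] H => S x) h)

lemma IsMAccretive.posResolvent_apply (hD : IsMAccretive D) {t : ℝ} (ht : 0 < t) (u : D.domain) :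
    posResolvent D t (D u) = u - (t : ℂ) • posResolvent D t u := by
  have h := (hD.isResolvent ht).2 u
  rw [map_sub, map_smul] at h
  rw [eq_sub_iff_add_eq]
  convert! h using 1
  module

/-- An m-accretive operator in a Hilbert space is densely defined. If `x` is orthogonal to `dom D`,
then `u = (D + 1)⁻¹ x` is orthogonal to `x`, and since `u = (D + t)⁻¹ (x + (t - 1) u)` the resolvent
bounds give `t² ‖u‖² ≤ ‖x‖² + (t - 1)² ‖u‖²` for all `t > 0`, which for large `t` forces `u = 0`. -/
lemma IsMAccretive.dense_domain [CompleteSpace H] (hD : IsMAccretive D) :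
    Dense (D.domain : Set H) := by
  rw [Submodule.dense_iff_topologicalClosure_eq_top,
    Submodule.topologicalClosure_eq_top_iff, Submodule.eq_bot_iff]
  intro x hx
  have hr := hD.isPseudoResolvent
  set u := posResolvent D 1 x with hu
  have hmem : u ∈ D.domain := (hD.isResolvent one_pos).mem_domain x
  have hinner : inner ℂ u x = 0 := (Submodule.mem_orthogonal _ _).1 hx u hmem
  -- `u = (D + t)⁻¹ (x + (t - 1) u)` for all `t`
  have key : ∀ t : ℝ, 0 < t → t * ‖u‖ ≤ ‖x + (t - 1) • u‖ := by
    intro t ht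
    have h1 : u = posResolvent D t (x + (t - 1) • u) := by
      have h2 := congrArg (fun S : H →L[ℂ] H => S x) (hr.sub_eq 1 t one_pos ht)
      simp only [sub_apply, smul_apply,
        mul_apply_eq_comp] at h2
      rw [map_add, ← Complex.coe_smul, map_smul, Complex.coe_smul, hu, ← sub_eq_iff_eq_add', h2]
      congr 1
      have h3 := congrArg (fun S : H →L[ℂ] H => S x) (hr.comm one_pos ht)
      simpa using h3
    have h2 : ‖u‖ ≤ t⁻¹ * ‖x + (t - 1) • u‖ := by
      nth_rewrite 1 [h1]
      exact (ContinuousLinearMap.le_opNorm _ _).trans (by gcongr; exact hr.norm_le t ht)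
    calc t * ‖u‖ ≤ t * (t⁻¹ * ‖x + (t - 1) • u‖) := by gcongr
      _ = _ := by field_simp
  have hsq : ∀ t : ℝ, 0 < t → (t * ‖u‖) ^ 2 ≤ ‖x‖ ^ 2 + (t - 1) ^ 2 * ‖u‖ ^ 2 := by
    intro t ht
    have h1 : ‖x + (t - 1) • u‖ ^ 2 = ‖x‖ ^ 2 + (t - 1) ^ 2 * ‖u‖ ^ 2 := by
      have h2 : inner ℂ x ((t - 1) • u) = 0 := by
        rw [← Complex.coe_smul, inner_smul_right, ← inner_conj_symm, hinner]
        simp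
      have h3 := norm_add_sq (𝕜 := ℂ) x ((t - 1) • u)
      rw [h3, h2, norm_smul, mul_pow, Real.norm_eq_abs, sq_abs]
      simp
    rw [← h1]
    exact pow_le_pow_left₀ (by positivity) (key t ht) 2
  have hu0 : ‖u‖ ^ 2 = 0 := by
    by_contra hne
    have hpos : 0 < ‖u‖ ^ 2 := lt_of_le_of_ne (by positivity) (Ne.symm hne)
    have h1 := hsq (‖x‖ ^ 2 / ‖u‖ ^ 2 + 1) (by positivity)
    have h2 : ‖x‖ ^ 2 = ‖x‖ ^ 2 / ‖u‖ ^ 2 * ‖u‖ ^ 2 :=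
      (div_mul_cancel₀ _ hne).symm
    have h3 : 0 ≤ ‖x‖ ^ 2 / ‖u‖ ^ 2 * ‖u‖ ^ 2 := by positivity
    nlinarith
  have hu1 : u = 0 := by simpa using hu0
  exact (injective_iff_map_eq_zero _).1 (hD.isResolvent one_pos).injective x hu1

variable {a b : ℝ}

lemma isResolvent_addScalar (hD : IsMAccretive D) (ha : 0 ≤ a) {t : ℝ} (ht : 0 < t) :
    IsResolvent (addScalar D (a : ℂ)) (-(t : ℂ)) (posResolvent D (t + a)) := by
  refine IsResolvent.addScalar ?_
  have := hD.isResolvent (add_pos_of_pos_of_nonneg ht ha)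
  convert! this using 1
  push_cast
  ring

/-- The integrand of Balakrishnan's formula for `D + a`. -/
lemma sqrtIntegrand_addScalar (hD : IsMAccretive D) (ha : 0 ≤ a) (u : D.domain) {x : ℝ}
    (hx : 0 < x) : sqrtIntegrand (addScalar D (a : ℂ)) u x =
      x ^ (-(1 / 2) : ℝ) • posResolvent D (x + a) (D u + (a : ℂ) • (u : H)) := by
  change ((x ^ (-(1 / 2) : ℝ) : ℝ) : ℂ) •
    resolvent (addScalar D (a : ℂ)) (-(x : ℂ)) (D u + (a : ℂ) • (u : H)) = _
  rw [(isResolvent_addScalar hD ha hx).resolvent_eq, Complex.coe_smul]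

lemma integrableOn_sqrtIntegrand (hD : IsMAccretive D) (ha : 0 ≤ a) (u : D.domain) :
    IntegrableOn (sqrtIntegrand (addScalar D (a : ℂ)) u) (Ioi 0) := by
  have hr := hD.isPseudoResolvent
  set v := D u + (a : ℂ) • (u : H) with hv
  refine IntegrableOn.congr_fun (f := fun x : ℝ => x ^ (-(1 / 2) : ℝ) • posResolvent D (x + a) v)
    ?_ (fun x hx => (sqrtIntegrand_addScalar hD ha u hx).symm) measurableSet_Ioi
  refine integrableOn_of_norm_le_weight (t := 1) (C := ‖v‖ + 2 * ‖(u : H)‖) one_pos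
    (continuousOn_rpow_weight.smul ((hr.continuousOn_add ha).clm_apply continuousOn_const))
    fun x hx => ?_
  have hx0 : (0 : ℝ) < x := hx
  rw [norm_smul, Real.norm_of_nonneg (by positivity)]
  have h1 : ‖posResolvent D (x + a)‖ ≤ x⁻¹ := hr.norm_le_of_le hx0 (by linarith)
  have h2 : x * ‖posResolvent D (x + a) v‖ ≤ ‖v‖ := by
    calc _ ≤ x * (x⁻¹ * ‖v‖) := by
          gcongr
          exact (ContinuousLinearMap.le_opNorm _ _).trans (by gcongr)
      _ = _ := by field_simp
  have h3 : ‖posResolvent D (x + a) v‖ ≤ 2 * ‖(u : H)‖ := by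
    have e : posResolvent D (x + a) v = (u : H) - (x : ℂ) • posResolvent D (x + a) u := by
      rw [hv, map_add, hD.posResolvent_apply (by linarith), map_smul]
      push_cast
      module
    have h4 : ‖(x : ℂ) • posResolvent D (x + a) u‖ ≤ ‖(u : H)‖ := by
      rw [norm_smul, Complex.norm_real, Real.norm_of_nonneg hx0.le]
      calc _ ≤ x * (x⁻¹ * ‖(u : H)‖) := by
            gcongr
            exact (ContinuousLinearMap.le_opNorm _ _).trans (by gcongr)
        _ = _ := by field_simp
    rw [e]
    linarith [norm_sub_le (u : H) ((x : ℂ) • posResolvent D (x + a) u)]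
  calc _ ≤ x ^ (-(1 / 2) : ℝ) * ((‖v‖ + 2 * ‖(u : H)‖) * (x + 1)⁻¹) := by
        gcongr
        rw [← div_eq_mul_inv, le_div_iff₀ (by positivity)]
        linarith
    _ = _ := by ring

lemma balakrishnan_domain (hD : IsMAccretive D) (ha : 0 ≤ a) :
    (balakrishnan (addScalar D (a : ℂ))).domain = D.domain := by
  ext u
  exact ⟨fun h => h.1, fun h => ⟨h, integrableOn_sqrtIntegrand hD ha ⟨u, h⟩⟩⟩

lemma balakrishnan_apply (hD : IsMAccretive D) (ha : 0 ≤ a)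
    (u : (balakrishnan (addScalar D (a : ℂ))).domain) :
    balakrishnan (addScalar D (a : ℂ)) u = Real.pi⁻¹ • ∫ x in Ioi (0 : ℝ),
      x ^ (-(1 / 2) : ℝ) • posResolvent D (x + a) (D ⟨u, u.2.1⟩ + (a : ℂ) • (u : H)) := by
  rw [← Complex.coe_smul]
  change ((Real.pi⁻¹ : ℝ) : ℂ) • ∫ lam in Ioi (0 : ℝ),
    sqrtIntegrand (addScalar D (a : ℂ)) ⟨u, u.2.1⟩ lam = _
  congr 1
  exact setIntegral_congr_fun measurableSet_Ioi fun x hx =>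
    sqrtIntegrand_addScalar hD ha ⟨u, u.2.1⟩ hx

/-- If a bounded injective `S` satisfies `S (f u + W u) = u` on `dom f`, and the vectors `f u + W u`
are dense, then the graph of the closure of `f` consists of all `(x, y)` with `S (y + W x) = x`. -/
lemma mem_graph_closure_iff {f : H →ₗ.[ℂ] H} {S W : H →L[ℂ] H} (hS : Function.Injective S)
    (hf : ∀ u : f.domain, S (f u + W u) = u)
    (hd : Dense (Set.range fun u : f.domain => f u + W u)) (p : H × H) :
    p ∈ f.closure.graph ↔ S (p.2 + W p.1) = p.1 := by
  let C : Submodule ℂ (H × H) := LinearMap.ker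
    ((S ∘L (ContinuousLinearMap.snd ℂ H H + W ∘L ContinuousLinearMap.fst ℂ H H) -
      ContinuousLinearMap.fst ℂ H H : H × H →L[ℂ] H) : H × H →ₗ[ℂ] H)
  have hC : ∀ p, p ∈ C ↔ S (p.2 + W p.1) = p.1 := fun p => by
    simp [C, LinearMap.mem_ker, sub_eq_zero]
  have hclosed : _root_.IsClosed (C : Set (H × H)) := ContinuousLinearMap.isClosed_ker _
  have heq : f.graph.topologicalClosure = C := by
    apply le_antisymm
    · refine Submodule.topologicalClosure_minimal _ ?_ hclosed
      rintro ⟨x, y⟩ hxy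
      obtain ⟨u, rfl, rfl⟩ := (LinearPMap.mem_graph_iff f).1 hxy
      exact (hC _).2 (hf u)
    · intro p hp
      have hp' := (hC p).1 hp
      have hcont : Continuous fun w : H => (S w, w - W (S w)) := by fun_prop
      have h1 : (fun w : H => (S w, w - W (S w))) (p.2 + W p.1) ∈ closure (f.graph : Set (H × H)) :=
        map_mem_closure (f := fun w : H => (S w, w - W (S w))) hcont (hd (p.2 + W p.1)) (by
          rintro _ ⟨u, rfl⟩
          refine (LinearPMap.mem_graph_iff f).2 ⟨u, (hf u).symm, ?_⟩
          dsimp only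
          rw [hf u]
          abel)
      have h2 : (fun w : H => (S w, w - W (S w))) (p.2 + W p.1) = p := by
        ext
        · exact hp'
        · simp [hp']
      rw [h2] at h1
      exact h1
  have hgraph : C.toLinearPMap.graph = C := by
    refine Submodule.toLinearPMap_graph_eq _ fun p hp h0 => ?_
    have := (hC p).1 hp
    rw [h0, map_zero, add_zero] at this
    exact (injective_iff_map_eq_zero S).1 hS _ this
  have hcl : f.IsClosable := ⟨C.toLinearPMap, heq.trans hgraph.symm⟩
  rw [← hcl.graph_closure_eq_closure_graph, heq, hC]

variable [CompleteSpace H]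

/-- On `dom D`, adding `sqrtDiff` to Balakrishnan's operator for `D + a` gives the one for `D + b`,
which is `(D + b)^{-1/2} (D + b)` there. -/
lemma balakrishnan_add_sqrtDiff (hD : IsMAccretive D) (ha : 0 ≤ a) (hab : a ≤ b) (hb : 0 < b)
    (u : (balakrishnan (addScalar D (a : ℂ))).domain) :
    balakrishnan (addScalar D (a : ℂ)) u + sqrtDiff (posResolvent D) a b u =
      resolventSqrt (posResolvent D) b (D ⟨u, u.2.1⟩ + (b : ℂ) • (u : H)) := by
  have hr := hD.isPseudoResolvent
  have hia : IntegrableOn (fun x : ℝ => x ^ (-(1 / 2) : ℝ) •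
      posResolvent D (x + a) (D ⟨u, u.2.1⟩ + (a : ℂ) • (u : H))) (Ioi 0) :=
    (integrableOn_sqrtIntegrand hD ha ⟨u, u.2.1⟩).congr_fun
      (fun x hx => sqrtIntegrand_addScalar hD ha ⟨u, u.2.1⟩ hx) measurableSet_Ioi
  rw [balakrishnan_apply hD ha, resolventSqrt, sqrtDiff, smul_apply,
    smul_apply, ContinuousLinearMap.integral_apply (hr.integrableOn hb),
    ContinuousLinearMap.integral_apply (hr.integrableOn_sqrtDiff ha hab hb), ← smul_add,
    ← integral_add hia ((hr.integrableOn_sqrtDiff ha hab hb).apply_continuousLinearMap (u : H))]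
  congr 1
  refine setIntegral_congr_fun measurableSet_Ioi fun x hx => ?_
  have hx0 : (0 : ℝ) < x := hx
  have hxa : 0 < x + a := by linarith
  have hxb : 0 < x + b := by linarith
  have h1 : (b - a) • (posResolvent D (x + a) * posResolvent D (x + b)) =
      posResolvent D (x + a) - posResolvent D (x + b) := by
    rw [hr.sub_eq (x + a) (x + b) hxa hxb]
    congr 1; ring
  have h2 : ∀ d : D.domain, posResolvent D (x + a) (D d + (a : ℂ) • (d : H)) +
      x • (posResolvent D (x + a) - posResolvent D (x + b)) (d : H) =
      posResolvent D (x + b) (D d + (b : ℂ) • (d : H)) := fun d => by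
    rw [map_add, map_add, hD.posResolvent_apply hxa, hD.posResolvent_apply hxb, map_smul, map_smul,
      sub_apply, ← Complex.coe_smul]
    push_cast
    module
  rw [mul_smul, h1, smul_apply, mul_smul, ← smul_add]
  exact congrArg _ (h2 ⟨u, u.2.1⟩)

lemma resolventSqrt_injective (hD : IsMAccretive D) (ha : 0 < a) :
    Function.Injective (resolventSqrt (posResolvent D) a : H →L[ℂ] H) := by
  rw [injective_iff_map_eq_zero]
  intro x hx
  refine (injective_iff_map_eq_zero _).1 (hD.isResolvent ha).injective x ?_
  rw [← hD.isPseudoResolvent.resolventSqrt_mul_self ha, mul_apply_eq_comp, hx, map_zero]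

lemma resolventSqrt_resolventSqrt (hD : IsMAccretive D) (ha : 0 < a) (u : D.domain) :
    resolventSqrt (posResolvent D) a
      (resolventSqrt (posResolvent D) a (D u + (a : ℂ) • (u : H))) = u := by
  rw [← mul_apply_eq_comp, hD.isPseudoResolvent.resolventSqrt_mul_self ha]
  simpa using (hD.isResolvent ha).2 u

lemma dense_range_resolventSqrt (hD : IsMAccretive D) (ha : 0 < a) :
    Dense (Set.range fun u : D.domain =>
      resolventSqrt (posResolvent D) a (D u + (a : ℂ) • (u : H))) := by
  have h1 : Dense (Set.range (resolventSqrt (posResolvent D) a : H →L[ℂ] H)) := by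
    refine hD.dense_domain.mono fun u hu => ?_
    exact ⟨_, resolventSqrt_resolventSqrt hD ha ⟨u, hu⟩⟩
  refine h1.mono ?_
  rintro _ ⟨x, rfl⟩
  refine ⟨⟨posResolvent D a x, (hD.isResolvent ha).mem_domain x⟩, ?_⟩
  dsimp only
  rw [(hD.isResolvent ha).apply_eq]
  congr 1
  module

lemma mem_graph_sqrt_iff (hD : IsMAccretive D) (ha : 0 ≤ a) (hab : a ≤ b) (hb : 0 < b)
    (p : H × H) : p ∈ (sqrt (addScalar D (a : ℂ))).graph ↔
      resolventSqrt (posResolvent D) b (p.2 + sqrtDiff (posResolvent D) a b p.1) = p.1 := by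
  refine mem_graph_closure_iff (resolventSqrt_injective hD hb) (fun u => ?_) ?_ p
  · rw [balakrishnan_add_sqrtDiff hD ha hab hb,
      resolventSqrt_resolventSqrt hD hb ⟨u, u.2.1⟩]
  · refine (dense_range_resolventSqrt hD hb).mono ?_
    rintro _ ⟨u, rfl⟩
    exact ⟨⟨u, (balakrishnan_domain hD ha).symm ▸ u.2⟩, balakrishnan_add_sqrtDiff hD ha hab hb _⟩

/-- The domain of `D^{1/2}` is the range of `(D + b)^{-1/2}`. -/
theorem mem_sqrt_domain_iff (hD : IsMAccretive D) (hb : 0 < b) (x : H) :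
    x ∈ (sqrt D).domain ↔ ∃ y, resolventSqrt (posResolvent D) b y = x := by
  have h0 : addScalar D ((0 : ℝ) : ℂ) = D :=
    LinearPMap.ext rfl fun u hu hu' => by
      change D ⟨u, hu⟩ + ((0 : ℝ) : ℂ) • u = D ⟨u, hu⟩
      simp
  have h := fun y => mem_graph_sqrt_iff hD le_rfl hb.le hb (x, y)
  rw [h0] at h
  rw [LinearPMap.mem_domain_iff]
  constructor
  · rintro ⟨y, hy⟩
    exact ⟨_, (h y).1 hy⟩
  · rintro ⟨y, hy⟩
    refine ⟨y - sqrtDiff (posResolvent D) 0 b x, (h _).2 ?_⟩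
    simpa using hy

/-- `invSqrt D b` is the everywhere defined bounded operator `resolventSqrt (posResolvent D) b`. -/
theorem invSqrt_eq (hD : IsMAccretive D) (hb : 0 < b) :
    invSqrt D b = ofBounded (resolventSqrt (posResolvent D) b) := by
  have h : ∀ p, p ∈ (sqrt (addScalar D (b : ℂ))).graph ↔
      resolventSqrt (posResolvent D) b p.2 = p.1 := fun p => by
    have := mem_graph_sqrt_iff hD hb.le le_rfl hb p
    rwa [show sqrtDiff (posResolvent D) b b = 0 by simp [sqrtDiff], zero_apply,
      add_zero] at this
  have hker : LinearMap.ker (sqrt (addScalar D (b : ℂ))).toFun = ⊥ := by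
    rw [LinearMap.ker_eq_bot']
    intro u hu
    have h1 := (h _).1 ((sqrt (addScalar D (b : ℂ))).mem_graph u)
    have hu' : sqrt (addScalar D (b : ℂ)) u = 0 := hu
    rw [hu', map_zero] at h1
    exact Subtype.ext h1.symm
  refine LinearPMap.eq_of_eq_graph ?_
  rw [invSqrt, LinearPMap.inverse_graph hker]
  ext ⟨x, y⟩
  have e1 : (x, y) ∈ (ofBounded (resolventSqrt (posResolvent D) b)).graph ↔
      resolventSqrt (posResolvent D) b x = y := by
    rw [LinearPMap.mem_graph_iff]
    constructor
    · rintro ⟨u, rfl, rfl⟩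
      rfl
    · rintro rfl
      exact ⟨⟨x, trivial⟩, rfl, rfl⟩
  rw [e1, ← h (y, x), Submodule.mem_map]
  constructor
  · rintro ⟨⟨p, q⟩, hp, hpq⟩
    obtain ⟨rfl, rfl⟩ := Prod.mk.inj hpq
    exact hp
  · intro hp
    exact ⟨(y, x), hp, rfl⟩

end Accretive

/-! ### Bounded extensions of densely defined operators -/

section BoundedExtension

variable {E F G : Type*}
  [NormedAddCommGroup E] [InnerProductSpace ℂ E]
  [NormedAddCommGroup F] [InnerProductSpace ℂ F]
  [NormedAddCommGroup G] [InnerProductSpace ℂ G]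

lemma eq_of_dense_domain {f : E →ₗ.[ℂ] F} (hd : Dense (f.domain : Set E)) {S S' : E →L[ℂ] G}
    (h : ∀ x : f.domain, S x = S' x) : S = S' :=
  DFunLike.coe_injective (Continuous.ext_on hd S.continuous S'.continuous fun x hx => h ⟨x, hx⟩)

lemma boundedClosure_eq {f : E →ₗ.[ℂ] F} (hd : Dense (f.domain : Set E)) {S : E →L[ℂ] F}
    (h : IsBoundedExtension f S) : boundedClosure f = S := by
  have hex : Dense (f.domain : Set E) ∧ ∃ S : E →L[ℂ] F, IsBoundedExtension f S := ⟨hd, S, h⟩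
  rw [boundedClosure, dif_pos hex]
  exact eq_of_dense_domain hd fun x => (hex.2.choose_spec x).trans (h x).symm

lemma apply_eq_of_mem_graph {f : E →ₗ.[ℂ] F} {x : E} {y : F} (h : (x, y) ∈ f.graph)
    (hx : x ∈ f.domain) : f ⟨x, hx⟩ = y := by
  obtain ⟨u, rfl, rfl⟩ := (LinearPMap.mem_graph_iff f).1 h
  rfl

lemma norm_apply_le_opNorm {f : E →ₗ.[ℂ] F} (hf : opNorm f ≠ ∞) (u : f.domain) :
    ‖f u‖ ≤ (opNorm f).toReal * ‖(u : E)‖ := by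
  rcases eq_or_ne u 0 with rfl | hu
  · simp [f.map_zero]
  have hu0 : 0 < ‖(u : E)‖ := norm_pos_iff.2 (by simpa using hu)
  set v : f.domain := ((‖(u : E)‖⁻¹ : ℝ) : ℂ) • u with hv
  have hv1 : ‖(v : E)‖ ≤ 1 := by
    rw [hv, Submodule.coe_smul, norm_smul, Complex.norm_real, norm_inv, norm_norm,
      inv_mul_cancel₀ hu0.ne']
  have h1 : ‖f v‖ₑ ≤ opNorm f :=
    le_iSup (fun x : {x : f.domain // ‖(x : E)‖ ≤ 1} => ‖f x.1‖ₑ) ⟨v, hv1⟩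
  have h2 : ‖f v‖ ≤ (opNorm f).toReal := by
    rw [← toReal_enorm]
    exact ENNReal.toReal_mono hf h1
  rw [hv, f.map_smul, norm_smul, Complex.norm_real, norm_inv, norm_norm, inv_mul_le_iff₀ hu0] at h2
  linarith

lemma enorm_le_opNorm {f : E →ₗ.[ℂ] F} (hd : Dense (f.domain : Set E)) {S : E →L[ℂ] F}
    (h : IsBoundedExtension f S) : ‖S‖ₑ ≤ opNorm f := by
  by_cases hf : opNorm f = ∞
  · simp [hf]
  have hb : ‖S‖ ≤ (opNorm f).toReal := by
    refine ContinuousLinearMap.opNorm_le_bound _ ENNReal.toReal_nonneg fun x => ?_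
    have hclosed : _root_.IsClosed {x : E | ‖S x‖ ≤ (opNorm f).toReal * ‖x‖} :=
      isClosed_le (by fun_prop) (by fun_prop)
    have hsub : (f.domain : Set E) ⊆ {x : E | ‖S x‖ ≤ (opNorm f).toReal * ‖x‖} := fun u hu => by
      have := norm_apply_le_opNorm hf ⟨u, hu⟩
      rwa [← h ⟨u, hu⟩] at this
    exact hclosed.closure_subset_iff.2 hsub (hd x)
  rw [← ofReal_norm]
  exact ENNReal.ofReal_le_of_le_toReal hb

lemma exists_isBoundedExtension [CompleteSpace F] {f : E →ₗ.[ℂ] F}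
    (hd : Dense (f.domain : Set E)) (hf : opNorm f ≠ ∞) :
    ∃ S : E →L[ℂ] F, IsBoundedExtension f S := by
  have hr : DenseRange f.domain.subtype := by
    rw [DenseRange, Submodule.coe_subtype, Subtype.range_coe]
    exact hd
  exact ⟨f.toFun.extendOfNorm f.domain.subtype, fun x =>
    LinearMap.extendOfNorm_eq hr ⟨_, fun u => norm_apply_le_opNorm hf u⟩ x⟩

lemma opNorm_mono {f g : E →ₗ.[ℂ] F} (h : f ≤ g) : opNorm f ≤ opNorm g := by
  refine iSup_le fun ⟨x, hx⟩ => ?_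
  have e : f x = g ⟨x, h.1 x.2⟩ := h.2 rfl
  rw [e]
  exact le_iSup (fun x : {x : g.domain // ‖(x : E)‖ ≤ 1} => ‖g x.1‖ₑ) ⟨⟨x, h.1 x.2⟩, hx⟩

/-- The closed graph theorem: `A S` is bounded if `A` is closed, `S` is bounded, and the range of
`S` lies in `dom A`. -/
lemma exists_comp_bounded [CompleteSpace E] [CompleteSpace G] {A : F →ₗ.[ℂ] G} (hA : A.IsClosed)
    (S : E →L[ℂ] F) (hS : ∀ x, S x ∈ A.domain) :
    ∃ Q : E →L[ℂ] G, ∀ x, A ⟨S x, hS x⟩ = Q x := by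
  let g : E →ₗ[ℂ] G := A.toFun ∘ₗ (S : E →ₗ[ℂ] F).codRestrict A.domain hS
  have hg : _root_.IsClosed (g.graph : Set (E × G)) := by
    have e : (g.graph : Set (E × G)) =
        (fun p : E × G => (S p.1, p.2)) ⁻¹' (A.graph : Set (F × G)) := by
      ext ⟨x, y⟩
      simp only [SetLike.mem_coe, LinearMap.mem_graph_iff, mem_preimage]
      constructor
      · rintro rfl
        exact (LinearPMap.mem_graph_iff A).2 ⟨⟨S x, hS x⟩, rfl, rfl⟩
      · intro h
        exact (apply_eq_of_mem_graph h (hS x)).symm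
    rw [e]
    exact _root_.IsClosed.preimage (by fun_prop) hA
  exact ⟨ContinuousLinearMap.ofIsClosedGraph hg, fun x => rfl⟩

/-- The adjoint of a densely defined closed operator is densely defined: a vector `x` orthogonal to
`dom B*` gives `(0, x)` in the closed graph of `B`, as otherwise a functional separates the two,
whose second component lies in `dom B*` and is not orthogonal to `x`. -/
lemma dense_adjoint_domain [CompleteSpace E] [CompleteSpace F] {B : E →ₗ.[ℂ] F}
    (hcl : B.IsClosed) : Dense (B.adjoint.domain : Set F) := by
  rw [Submodule.dense_iff_topologicalClosure_eq_top,
    Submodule.topologicalClosure_eq_top_iff, Submodule.eq_bot_iff]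
  intro x hx
  by_contra hne
  have : _root_.IsClosed (B.graph : Set (E × F)) := hcl
  have hnm : ((0, x) : E × F) ∉ B.graph := fun h => hne (B.graph_fst_eq_zero_snd h rfl)
  have hq : B.graph.mkQ (0, x) ≠ 0 := by
    rwa [Ne, Submodule.mkQ_apply, Submodule.Quotient.mk_eq_zero]
  obtain ⟨g, -, hgx⟩ := exists_dual_vector ℂ (B.graph.mkQ (0, x)) (norm_ne_zero_iff.2 hq)
  let φ : StrongDual ℂ (E × F) := g ∘L B.graph.mkQL
  have hφ : ∀ p ∈ B.graph, φ p = 0 := fun p hp => by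
    have : B.graph.mkQ p = 0 := by rwa [Submodule.mkQ_apply, Submodule.Quotient.mk_eq_zero]
    exact (congrArg g this).trans (map_zero g)
  have hφx : φ (0, x) ≠ 0 := by
    have : φ (0, x) = ‖B.graph.mkQ (0, x)‖ := hgx
    rw [this]
    simpa using hq
  let y := (InnerProductSpace.toDual ℂ E).symm (φ ∘L ContinuousLinearMap.inl ℂ E F)
  let w := (InnerProductSpace.toDual ℂ F).symm (φ ∘L ContinuousLinearMap.inr ℂ E F)
  have hy : ∀ u, inner ℂ y u = φ (u, 0) := fun u => InnerProductSpace.toDual_symm_apply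
  have hw : ∀ v, inner ℂ w v = φ (0, v) := fun v => InnerProductSpace.toDual_symm_apply
  have hmem : w ∈ B.adjoint.domain := by
    refine LinearPMap.mem_adjoint_domain_of_exists w ⟨-y, fun u => ?_⟩
    have h1 := hφ _ (B.mem_graph u)
    have h2 : ((u : E), B u) = ((u : E), (0 : F)) + ((0 : E), B u) := by simp
    rw [h2, map_add, ← hy, ← hw] at h1
    rw [inner_neg_left]
    exact neg_eq_of_add_eq_zero_right h1
  refine hφx ?_
  rw [← hw]
  exact (Submodule.mem_orthogonal _ _).1 hx w hmem

end BoundedExtension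

/-! ### Kato's resolvent formula -/

section Kato

variable {H K : Type*}
  [NormedAddCommGroup H] [InnerProductSpace ℂ H] [CompleteSpace H]
  [NormedAddCommGroup K] [InnerProductSpace ℂ K]

/-- The bounded operators of Kato's formula at a point `z` of `ρ(T₀)`: `R = (T₀ - z)⁻¹`,
`G = A (T₀ - z)⁻¹`, `F` the closure of `(T₀ - z)⁻¹ B*` and `Q` the closure of `-A (T₀ - z)⁻¹ B*`. -/
structure IsKatoData (T₀ : H →ₗ.[ℂ] H) (A B : H →ₗ.[ℂ] K) (z : ℂ)
    (R : H →L[ℂ] H) (G : H →L[ℂ] K) (F : K →L[ℂ] H) (Q : K →L[ℂ] K) : Prop where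
  resolvent : IsResolvent T₀ z R
  left : ∀ x, (R x, G x) ∈ A.graph
  right : ∀ v : B.adjoint.domain, F v = R (B.adjoint v)
  middle : ∀ v : B.adjoint.domain, Q v = -G (B.adjoint v)

variable {T₀ : H →ₗ.[ℂ] H} {A B : H →ₗ.[ℂ] K} {z w : ℂ}
  {R R' : H →L[ℂ] H} {G G' : H →L[ℂ] K} {F F' : K →L[ℂ] H} {Q Q' : K →L[ℂ] K}

namespace IsKatoData

lemma resolvent_sub_apply (h : IsKatoData T₀ A B z R G F Q) (h' : IsKatoData T₀ A B w R' G' F' Q')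
    (x : H) : R x - R' x = (z - w) • R (R' x) := by
  simpa using congrArg (fun S : H →L[ℂ] H => S x) (h.resolvent.sub_eq h'.resolvent)

lemma left_sub_apply (h : IsKatoData T₀ A B z R G F Q) (h' : IsKatoData T₀ A B w R' G' F' Q')
    (x : H) : G x - G' x = (z - w) • G (R' x) := by
  have h1 := A.graph.sub_mem (A.graph.sub_mem (h.left x) (h'.left x))
    (A.graph.smul_mem (z - w) (h.left (R' x)))
  refine sub_eq_zero.1 (A.graph_fst_eq_zero_snd h1 ?_)
  simpa using sub_eq_zero.2 (h.resolvent_sub_apply h' x)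

lemma right_sub_apply (hB : Dense (B.adjoint.domain : Set K)) (h : IsKatoData T₀ A B z R G F Q)
    (h' : IsKatoData T₀ A B w R' G' F' Q') (v : K) :
    F v - F' v = (z - w) • R (F' v) := by
  have e : F - F' = (z - w) • R ∘L F' := eq_of_dense_domain hB fun v => by
    simpa [h.right, h'.right] using h.resolvent_sub_apply h' (B.adjoint v)
  simpa using congrArg (fun S : K →L[ℂ] H => S v) e

lemma middle_sub_apply (hB : Dense (B.adjoint.domain : Set K)) (h : IsKatoData T₀ A B z R G F Q)
    (h' : IsKatoData T₀ A B w R' G' F' Q') (v : K) :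
    Q' v - Q v = (z - w) • G (F' v) := by
  have e : Q' - Q = (z - w) • G ∘L F' := eq_of_dense_domain hB fun v => by
    have := h.left_sub_apply h' (B.adjoint v)
    simp only [sub_apply, smul_apply, ContinuousLinearMap.comp_apply, h.middle, h'.middle, h'.right]
    rw [← this]
    abel
  simpa using congrArg (fun S : K →L[ℂ] K => S v) e

/-- Kato's data at one point of `ρ(T₀)` determine those at any other point. -/
lemma transfer (h' : IsKatoData T₀ A B w R' G' F' Q') (hR : IsResolvent T₀ z R) :
    IsKatoData T₀ A B z R (G' + (z - w) • G' ∘L R) (F' + (z - w) • R ∘L F')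
      (Q' - (z - w) • (G' + (z - w) • G' ∘L R) ∘L F') := by
  have h1 : ∀ x, R x - R' x = (z - w) • R (R' x) := fun x => by
    simpa using congrArg (fun S : H →L[ℂ] H => S x) (hR.sub_eq h'.resolvent)
  have h2 : ∀ x, R x - R' x = (z - w) • R' (R x) := fun x => by
    have := congrArg (fun S : H →L[ℂ] H => S x) (h'.resolvent.sub_eq hR)
    simp only [sub_apply, smul_apply, mul_apply_eq_comp] at this
    rw [← neg_sub, ← neg_sub w z, neg_smul, ← this]
  refine ⟨hR, fun x => ?_, fun v => ?_, fun v => ?_⟩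
  · have h3 := A.graph.add_mem (h'.left x) (A.graph.smul_mem (z - w) (h'.left (R x)))
    convert! h3 using 1
    ext
    · simp [← h2 x]
    · simp
  · simp [h'.right, ← h1]
  · have h3 : G' (R (B.adjoint v) - R' (B.adjoint v)) = (z - w) • G' (R (R' (B.adjoint v))) := by
      rw [h1, map_smul]
    simp only [sub_apply, smul_apply, add_apply, ContinuousLinearMap.comp_apply, h'.middle,
      h'.right]
    rw [← h3, map_sub]
    module

lemma left_eq (h : IsKatoData T₀ A B z R G F Q) (h' : IsKatoData T₀ A B z R' G' F' Q') :
    G = G' := by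
  ext x
  simpa [sub_eq_zero] using h.left_sub_apply h' x

lemma right_eq (hB : Dense (B.adjoint.domain : Set K)) (h : IsKatoData T₀ A B z R G F Q)
    (h' : IsKatoData T₀ A B z R' G' F' Q') : F = F' := by
  ext x
  simpa [sub_eq_zero] using h.right_sub_apply hB h' x

lemma middle_eq (hB : Dense (B.adjoint.domain : Set K)) (h : IsKatoData T₀ A B z R G F Q)
    (h' : IsKatoData T₀ A B z R' G' F' Q') : Q = Q' := by
  ext x
  have := h.middle_sub_apply hB h' x
  rw [sub_self, zero_smul, sub_eq_zero] at this
  exact this.symm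

lemma dense_preBS_domain (hB : Dense (B.adjoint.domain : Set K))
    (h : IsKatoData T₀ A B z R G F Q) : Dense ((preBS T₀ A B z).domain : Set K) := by
  have hdom : (preBS T₀ A B z).domain = B.adjoint.domain := by
    ext v
    constructor
    · rintro ⟨⟨hv, -⟩, -⟩
      exact hv
    · intro hv
      refine ⟨⟨hv, trivial⟩, ?_⟩
      change SqrtDomain.resolvent T₀ z (B.adjoint ⟨v, hv⟩) ∈ A.domain
      rw [h.resolvent.resolvent_eq]
      exact LinearPMap.mem_domain_of_mem_graph (h.left _)
  rwa [hdom]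

lemma birmanSchwinger_eq (hB : Dense (B.adjoint.domain : Set K))
    (h : IsKatoData T₀ A B z R G F Q) : birmanSchwinger T₀ A B z = Q := by
  refine boundedClosure_eq (h.dense_preBS_domain hB) ?_
  rintro ⟨v, hv⟩
  obtain ⟨⟨hvB, hv1⟩, hv2⟩ := hv
  have e : preBS T₀ A B z ⟨v, ⟨⟨hvB, hv1⟩, hv2⟩⟩ =
      -A ⟨SqrtDomain.resolvent T₀ z (B.adjoint ⟨v, hvB⟩), hv2⟩ := rfl
  rw [e]
  refine (h.middle ⟨v, hvB⟩).trans (congrArg Neg.neg ?_)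
  have := h.left (B.adjoint ⟨v, hvB⟩)
  rw [← h.resolvent.resolvent_eq] at this
  exact (apply_eq_of_mem_graph this hv2).symm

lemma boundedClosure_right (hB : Dense (B.adjoint.domain : Set K))
    (h : IsKatoData T₀ A B z R G F Q) :
    boundedClosure (comp (ofBounded (SqrtDomain.resolvent T₀ z)) B.adjoint) = F := by
  refine boundedClosure_eq ?_ ?_
  · exact hB.mono fun v hv => ⟨hv, trivial⟩
  · rintro ⟨v, hv, -⟩
    refine (h.right ⟨v, hv⟩).trans ?_
    rw [← h.resolvent.resolvent_eq]
    rfl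

lemma boundedClosure_left (h : IsKatoData T₀ A B z R G F Q) :
    boundedClosure (comp A (ofBounded (SqrtDomain.resolvent T₀ z))) = G := by
  have hG : ∀ x, (SqrtDomain.resolvent T₀ z x, G x) ∈ A.graph := fun x => by
    rw [h.resolvent.resolvent_eq]
    exact h.left x
  refine boundedClosure_eq ?_ ?_
  · exact dense_univ.mono fun x _ => ⟨trivial, LinearPMap.mem_domain_of_mem_graph (hG x)⟩
  · rintro ⟨x, -, hx⟩
    exact (apply_eq_of_mem_graph (hG x) hx).symm

lemma katoResolvent_eq (hB : Dense (B.adjoint.domain : Set K))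
    (h : IsKatoData T₀ A B z R G F Q) :
    katoResolvent T₀ A B z = R - F ∘L Ring.inverse (1 - Q) ∘L G := by
  rw [katoResolvent, h.birmanSchwinger_eq hB, h.boundedClosure_right hB, h.boundedClosure_left,
    h.resolvent.resolvent_eq]

/-- Since `A` is closed, `A F = -Q` holds on all of `K` and not only on `dom B*`. -/
lemma right_mem_graph (hB : Dense (B.adjoint.domain : Set K)) (hA : A.IsClosed)
    (h : IsKatoData T₀ A B z R G F Q) (v : K) : (F v, -Q v) ∈ A.graph := by
  have hcl : _root_.IsClosed ((fun v => (F v, -Q v)) ⁻¹' (A.graph : Set (H × K))) :=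
    _root_.IsClosed.preimage (by fun_prop) hA
  refine hcl.closure_subset_iff.2 (fun v hv => ?_) (hB v)
  change (F v, -Q v) ∈ A.graph
  have := h.left (B.adjoint ⟨v, hv⟩)
  rwa [← h.right ⟨v, hv⟩, ← neg_neg (G _), ← h.middle ⟨v, hv⟩] at this

variable {L L' : K →L[ℂ] K}

/-- Kato's resolvent is injective. -/
lemma kato_injective (hB : Dense (B.adjoint.domain : Set K)) (hA : A.IsClosed)
    (h : IsKatoData T₀ A B z R G F Q) (hL : (1 - Q) * L = 1) :
    Function.Injective (R - F ∘L L ∘L G) := by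
  rw [injective_iff_map_eq_zero]
  intro x hx
  have hy : L (G x) - Q (L (G x)) = G x := by
    simpa using congrArg (fun S : K →L[ℂ] K => S (G x)) hL
  have hRF : R x = F (L (G x)) := sub_eq_zero.1 hx
  have h1 : G x = -Q (L (G x)) := by
    have h2 := A.graph.sub_mem (h.left x) (h.right_mem_graph hB hA (L (G x)))
    exact sub_eq_zero.1 (A.graph_fst_eq_zero_snd h2 (by simp [hRF]))
  have h2 : L (G x) = 0 := by
    have h3 : L (G x) = L (G x) - Q (L (G x)) + Q (L (G x)) := by abel
    rw [h3, hy]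
    nth_rewrite 1 [h1]
    abel
  rw [h2, map_zero] at hRF
  exact (injective_iff_map_eq_zero R).1 h.resolvent.injective x hRF

/-- The first resolvent equation for Kato's resolvent. -/
lemma kato_sub_eq (hB : Dense (B.adjoint.domain : Set K))
    (h : IsKatoData T₀ A B z R G F Q) (h' : IsKatoData T₀ A B w R' G' F' Q')
    (hL : L * (1 - Q) = 1) (hL' : (1 - Q') * L' = 1) :
    (R - F ∘L L ∘L G) - (R' - F' ∘L L' ∘L G') =
      (z - w) • ((R - F ∘L L ∘L G) * (R' - F' ∘L L' ∘L G')) := by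
  ext x
  set y := L' (G' x) with hy
  have hy' : y - Q' y = G' x := by
    simpa [hy] using congrArg (fun S : K →L[ℂ] K => S (G' x)) hL'
  have e1 : (z - w) • R (R' x - F' y) = R x - R' x - (F y - F' y) := by
    rw [map_sub, smul_sub, h.resolvent_sub_apply h', h.right_sub_apply hB h']
  have e2 : (z - w) • L (G (R' x - F' y)) = L (G x) - y := by
    have e3 : (z - w) • G (R' x - F' y) = G x - (1 - Q) y := by
      rw [map_sub, smul_sub, ← h.left_sub_apply h', ← h.middle_sub_apply hB h', ← hy']
      simp only [sub_apply, one_apply_eq_self]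
      abel
    have e4 : L ((1 - Q) y) = y := by
      simpa using congrArg (fun S : K →L[ℂ] K => S y) hL
    rw [← map_smul, e3, map_sub, e4]
  simp only [sub_apply, smul_apply, mul_apply_eq_comp, ContinuousLinearMap.comp_apply]
  rw [← hy, smul_sub, e1, ← map_smul F, e2, map_sub]
  abel

/-- Kato's operator constructed from the point `z` has Kato's resolvent at every other point `w`. -/
theorem isResolvent_katoOperator (hB : Dense (B.adjoint.domain : Set K)) (hA : A.IsClosed)
    (h : IsKatoData T₀ A B z R G F Q) (h' : IsKatoData T₀ A B w R' G' F' Q')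
    (hQ : IsUnit (1 - Q)) (hQ' : IsUnit (1 - Q')) :
    IsResolvent (katoOperator T₀ A B z) w (R' - F' ∘L Ring.inverse (1 - Q') ∘L G') := by
  have l1 := Ring.inverse_mul_cancel _ hQ
  have l2 := Ring.mul_inverse_cancel _ hQ
  have l1' := Ring.inverse_mul_cancel _ hQ'
  have l2' := Ring.mul_inverse_cancel _ hQ'
  rw [katoOperator, h.katoResolvent_eq hB]
  refine isResolvent_addScalar_inverse (h.kato_injective hB hA l2) (h.kato_sub_eq hB h' l1 l2') ?_
  rw [← neg_sub, h'.kato_sub_eq hB h l1' l2, ← neg_smul, neg_sub]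

end IsKatoData

/-- If `A` vanishes on `dom T₀`, the perturbation is trivial. -/
lemma katoOperator_eq_of_forall_eq_zero (hdom : T₀.domain ≤ A.domain)
    (hA : ∀ u : T₀.domain, A ⟨u, hdom u.2⟩ = 0) (hz : z ∈ resolventSet T₀) :
    katoOperator T₀ A B z = T₀ := by
  have hR := isResolvent_resolvent hz
  have h0 : boundedClosure (comp A (ofBounded (resolvent T₀ z))) = 0 := by
    refine boundedClosure_eq ?_ ?_
    · exact dense_univ.mono fun x _ => ⟨trivial, hdom (hR.mem_domain x)⟩
    · rintro ⟨x, -, hx⟩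
      exact (hA ⟨resolvent T₀ z x, hR.mem_domain x⟩).symm
  rw [katoOperator, katoResolvent, h0, ContinuousLinearMap.comp_zero, ContinuousLinearMap.comp_zero,
    sub_zero]
  exact addScalar_inverse_eq hR

end Kato

/-! ### Comparison of the two inverse square roots -/

section Comparison

variable {H K : Type*}
  [NormedAddCommGroup H] [InnerProductSpace ℂ H] [CompleteSpace H]
  [NormedAddCommGroup K] [InnerProductSpace ℂ K]

/-- If `(T + x + E)⁻¹ = (T₀ + x + E)⁻¹ - (T₀ + E)^{-1/2} Y x` with a small weighted integral of `Y`,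
then `(T + E)^{-1/2} = (T₀ + E)^{-1/2} (I - M)` with `‖M‖ < 1`, so that both have the same range. -/
lemma sqrt_domain_eq_of_lintegral_le {T₀ T : H →ₗ.[ℂ] H} (h₀ : IsMAccretive T₀)
    (h : IsMAccretive T) {E : ℝ} (hE : 0 < E) {Y : ℝ → H →L[ℂ] H} (hYc : ContinuousOn Y (Ioi 0))
    (hY : ∀ x, 0 < x → posResolvent T (x + E) =
      posResolvent T₀ (x + E) - resolventSqrt (posResolvent T₀) E * Y x)
    (hint : ∫⁻ x in Ioi (0 : ℝ), ‖x ^ (-(1 / 2) : ℝ) • Y x‖ₑ ≤ 1) :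
    (sqrt T).domain = (sqrt T₀).domain := by
  set S : H →L[ℂ] H := resolventSqrt (posResolvent T₀) E
  have hi : IntegrableOn (fun x : ℝ => x ^ (-(1 / 2) : ℝ) • Y x) (Ioi 0) :=
    ⟨(continuousOn_rpow_weight.smul hYc).aestronglyMeasurable measurableSet_Ioi,
      hint.trans_lt ENNReal.one_lt_top⟩
  set M : H →L[ℂ] H := Real.pi⁻¹ • ∫ x in Ioi (0 : ℝ), x ^ (-(1 / 2) : ℝ) • Y x with hM
  have hM1 : ‖M‖ < 1 := by
    have h1 : ‖∫ x in Ioi (0 : ℝ), x ^ (-(1 / 2) : ℝ) • Y x‖ₑ ≤ 1 :=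
      (enorm_integral_le_lintegral_enorm _).trans hint
    have h2 : ‖∫ x in Ioi (0 : ℝ), x ^ (-(1 / 2) : ℝ) • Y x‖ ≤ 1 := by
      rw [← toReal_enorm]
      simpa using ENNReal.toReal_mono ENNReal.one_ne_top h1
    rw [hM, norm_smul, Real.norm_of_nonneg (by positivity)]
    calc _ ≤ Real.pi⁻¹ * 1 := by gcongr
      _ < 1 := by
        rw [mul_one]
        exact inv_lt_one_of_one_lt₀ (by linarith [Real.pi_gt_three])
  have hS : resolventSqrt (posResolvent T) E = S * (1 - M) := by
    have e1 : S * M = Real.pi⁻¹ • ∫ x in Ioi (0 : ℝ), S * (x ^ (-(1 / 2) : ℝ) • Y x) := by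
      rw [hM, mul_smul_comm, ← integral_const_mul_of_integrable hi]
    rw [mul_sub, mul_one, e1, resolventSqrt]
    change _ = Real.pi⁻¹ • (∫ x in Ioi (0 : ℝ), x ^ (-(1 / 2) : ℝ) • posResolvent T₀ (x + E)) - _
    rw [← smul_sub, ← integral_sub (h₀.isPseudoResolvent.integrableOn hE) (hi.const_mul S)]
    congr 1
    refine setIntegral_congr_fun measurableSet_Ioi fun x hx => ?_
    rw [hY x hx, smul_sub, mul_smul_comm]
  have hu : IsUnit (1 - M) := isUnit_one_sub_of_norm_lt_one hM1
  ext x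
  rw [mem_sqrt_domain_iff h hE, mem_sqrt_domain_iff h₀ hE, hS]
  constructor
  · rintro ⟨y, rfl⟩
    exact ⟨(1 - M) y, rfl⟩
  · rintro ⟨y, rfl⟩
    refine ⟨Ring.inverse (1 - M) y, ?_⟩
    have := congrArg (fun X : H →L[ℂ] H => S (X y)) (Ring.mul_inverse_cancel _ hu)
    exact this

lemma lintegral_rpow_weight_lt_top (R : ℝ) :
    ∫⁻ x in Ioc 0 R, ENNReal.ofReal (x ^ (-(1 / 2) : ℝ)) < ∞ :=
  (intervalIntegral.intervalIntegrable_rpow' (by norm_num)).1.lintegral_lt_top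

/-- The part of the integral over `(0, R]` is controlled by `sup N`, the part over `(R, ∞)` by the
logarithmic integral of `N`. -/
lemma lintegral_weight_le {V : Type*} [NormedAddCommGroup V] [NormedSpace ℝ V] {Y : ℝ → V}
    {N : ℝ → ℝ≥0∞} {R E : ℝ} {ε : ℝ≥0∞} (hR : 0 < R) (hE : 1 ≤ E) (hε : ε ≠ ∞)
    (hN : ∀ μ ≥ E, N μ ≤ ε)
    (hY : ∀ x, 0 < x → ‖Y x‖ₑ ≤ ENNReal.ofReal (4 * (√(x + E))⁻¹) * N (x + E)) :
    ∫⁻ x in Ioi (0 : ℝ), ‖x ^ (-(1 / 2) : ℝ) • Y x‖ₑ ≤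
      4 * ε * (∫⁻ x in Ioc 0 R, ENNReal.ofReal (x ^ (-(1 / 2) : ℝ))) +
        4 * ∫⁻ x in Ioi R, ENNReal.ofReal x⁻¹ * N (x + E) := by
  have h4 : ENNReal.ofReal 4 = 4 := by norm_num
  have hn : ∀ x : ℝ, 0 < x → ‖x ^ (-(1 / 2) : ℝ) • Y x‖ₑ ≤
      ENNReal.ofReal (x ^ (-(1 / 2) : ℝ)) * (ENNReal.ofReal (4 * (√(x + E))⁻¹) * N (x + E)) := by
    intro x hx
    rw [enorm_smul, Real.enorm_of_nonneg (by positivity)]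
    gcongr
    exact hY x hx
  rw [← Ioc_union_Ioi_eq_Ioi hR.le]
  refine (lintegral_union_le _ _ _).trans (add_le_add ?_ ?_)
  · rw [← lintegral_const_mul' _ _ (ENNReal.mul_ne_top (by simp) hε)]
    · refine setLIntegral_mono' measurableSet_Ioc fun x hx => (hn x hx.1).trans ?_
      have h1 : ENNReal.ofReal (4 * (√(x + E))⁻¹) ≤ 4 := by
        rw [← h4]
        refine ENNReal.ofReal_le_ofReal ?_
        have : (√(x + E))⁻¹ ≤ 1 :=
          inv_le_one_of_one_le₀ (Real.one_le_sqrt.2 (by linarith [hx.1]))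
        linarith
      calc _ ≤ ENNReal.ofReal (x ^ (-(1 / 2) : ℝ)) * (4 * ε) := by
            gcongr
            exact hN _ (by linarith [hx.1])
        _ = _ := by ring
  · rw [← lintegral_const_mul' _ _ (by simp)]
    refine setLIntegral_mono' measurableSet_Ioi fun x hx => ?_
    have hx0 : 0 < x := hR.trans hx
    refine (hn x hx0).trans ?_
    rw [← mul_assoc, ← mul_assoc, ← ENNReal.ofReal_mul (by positivity), ← h4,
      ← ENNReal.ofReal_mul (by positivity)]
    refine mul_le_mul_left (ENNReal.ofReal_le_ofReal ?_) _
    rw [rpow_weight_eq hx0]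
    have h1 : (√(x + E))⁻¹ ≤ (√x)⁻¹ :=
      inv_anti₀ (Real.sqrt_pos.2 hx0) (Real.sqrt_le_sqrt (by linarith))
    calc (√x)⁻¹ * (4 * (√(x + E))⁻¹) ≤ (√x)⁻¹ * (4 * (√x)⁻¹) := by gcongr
      _ = 4 * (√x * √x)⁻¹ := by rw [mul_inv]; ring
      _ = 4 * x⁻¹ := by rw [Real.mul_self_sqrt hx0.le]

/-- `‖(I - Q)⁻¹‖ ≤ 2` for `‖Q‖ ≤ 1/2`. -/
lemma norm_inverse_one_sub_le {Q : K →L[ℂ] K} (hu : IsUnit (1 - Q)) (hQ : ‖Q‖ ≤ 1 / 2) :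
    ‖Ring.inverse (1 - Q)‖ ≤ 2 := by
  set L := Ring.inverse (1 - Q)
  have e : L = 1 + Q * L := by
    have := Ring.mul_inverse_cancel _ hu
    rw [sub_mul, one_mul, sub_eq_iff_eq_add] at this
    exact this
  have h1 : ‖L‖ ≤ 1 + 1 / 2 * ‖L‖ :=
    calc ‖L‖ = ‖1 + Q * L‖ := congrArg _ e
      _ ≤ ‖(1 : K →L[ℂ] K)‖ + ‖Q‖ * ‖L‖ :=
        (norm_add_le _ _).trans (by gcongr; exact norm_mul_le _ _)
      _ ≤ _ := by
        gcongr
        exact ContinuousLinearMap.norm_id_le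
  linarith

variable {T₀ : H →ₗ.[ℂ] H} {A B : H →ₗ.[ℂ] K}

/-- Unless `A` vanishes on `dom T₀`, finiteness of `N(μ)` makes its second factor finite. (In
`[0, ∞]` the product may be finite as `0 * ∞`.) -/
lemma opNorm_closure_ne_top (h₀ : IsMAccretive T₀) (hdom : T₀.domain ≤ A.domain)
    (hA : ¬∀ u : T₀.domain, A ⟨u, hdom u.2⟩ = 0) {μ : ℝ} (hμ : 0 < μ)
    (hN : normProduct T₀ A B μ ≠ ∞) : opNorm (comp (invSqrt T₀ μ) B.adjoint).closure ≠ ∞ := by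
  intro htop
  rw [normProduct, htop] at hN
  refine hA fun u => ?_
  have h0 : opNorm (comp A (invSqrt T₀ μ)) = 0 := by
    by_contra hne
    exact hN (ENNReal.mul_top hne)
  rw [invSqrt_eq h₀ hμ] at h0
  have hu : (u : H) ∈ (sqrt T₀).domain :=
    (mem_sqrt_domain_iff h₀ hμ _).2 ⟨_, resolventSqrt_resolventSqrt h₀ hμ u⟩
  obtain ⟨y, hy⟩ := (mem_sqrt_domain_iff h₀ hμ (u : H)).1 hu
  have hmem : y ∈ (comp A (ofBounded (resolventSqrt (posResolvent T₀) μ))).domain :=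
    ⟨trivial, by
      change resolventSqrt (posResolvent T₀) μ y ∈ A.domain
      rw [hy]
      exact hdom u.2⟩
  have h1 := norm_apply_le_opNorm (by rw [h0]; exact ENNReal.zero_ne_top) ⟨y, hmem⟩
  rw [h0, ENNReal.toReal_zero, zero_mul, norm_le_zero_iff] at h1
  refine Eq.trans ?_ h1
  change A _ = A ⟨resolventSqrt (posResolvent T₀) μ y, _⟩
  congr 1
  exact Subtype.ext hy.symm

/-- The factorization of Kato's data at `-μ` through `(T₀ + μ)^{-1/2}`. -/
lemma exists_isKatoData [CompleteSpace K] (h₀ : IsMAccretive T₀) (hAcl : A.IsClosed)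
    (hA : (sqrt T₀).domain ≤ A.domain) (hB : Dense (B.adjoint.domain : Set K)) {μ : ℝ} (hμ : 0 < μ)
    (hfin : opNorm (comp (invSqrt T₀ μ) B.adjoint).closure ≠ ∞) :
    ∃ (Γ : H →L[ℂ] K) (Φ : K →L[ℂ] H),
      IsKatoData T₀ A B (-(μ : ℂ)) (posResolvent T₀ μ) (Γ ∘L resolventSqrt (posResolvent T₀) μ)
        (resolventSqrt (posResolvent T₀) μ ∘L Φ) (-(Γ ∘L Φ)) ∧
      ‖Γ‖ₑ * ‖Φ‖ₑ ≤ normProduct T₀ A B μ := by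
  set S : H →L[ℂ] H := resolventSqrt (posResolvent T₀) μ with hS
  have hSS : ∀ x, S (S x) = posResolvent T₀ μ x := fun x =>
    congrArg (fun X : H →L[ℂ] H => X x) (h₀.isPseudoResolvent.resolventSqrt_mul_self hμ)
  have hSA : ∀ x, S x ∈ A.domain := fun x => hA ((mem_sqrt_domain_iff h₀ hμ _).2 ⟨x, rfl⟩)
  obtain ⟨Γ, hΓ⟩ := exists_comp_bounded hAcl S hSA
  have hle := opNorm_mono (LinearPMap.le_closure (comp (invSqrt T₀ μ) B.adjoint))
  have hd2 : Dense ((comp (invSqrt T₀ μ) B.adjoint).domain : Set K) := by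
    rw [invSqrt_eq h₀ hμ]
    exact hB.mono fun v hv => ⟨hv, trivial⟩
  obtain ⟨Φ, hΦ⟩ := exists_isBoundedExtension hd2 (hle.trans_lt hfin.lt_top).ne
  have hΓn : ‖Γ‖ₑ ≤ opNorm (comp A (invSqrt T₀ μ)) := by
    rw [invSqrt_eq h₀ hμ]
    refine enorm_le_opNorm ?_ ?_
    · exact dense_univ.mono fun x _ => ⟨trivial, hSA x⟩
    · rintro ⟨x, -, hx⟩
      exact (hΓ x).symm
  have hΦn : ‖Φ‖ₑ ≤ opNorm (comp (invSqrt T₀ μ) B.adjoint).closure :=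
    (enorm_le_opNorm hd2 hΦ).trans hle
  have hΦ' : ∀ v : B.adjoint.domain, Φ v = S (B.adjoint v) := by
    rw [invSqrt_eq h₀ hμ] at hΦ
    exact fun v => hΦ ⟨v, ⟨v.2, trivial⟩⟩
  refine ⟨Γ, Φ, ⟨h₀.isResolvent hμ, fun x => ?_, fun v => ?_, fun v => ?_⟩, mul_le_mul' hΓn hΦn⟩
  · rw [← hSS]
    exact (LinearPMap.mem_graph_iff A).2 ⟨⟨S (S x), hSA _⟩, rfl, hΓ (S x)⟩
  · rw [← hSS, ContinuousLinearMap.comp_apply, hΦ']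
  · simp [hΦ']

/-- Near `-∞`, Kato's correction to the resolvent is `(T₀ + E)^{-1/2} Y` with
`‖Y‖ ≤ 4 N(x + E) (x + E)^{-1/2}` and `Y` continuous in `x`. -/
lemma exists_kato_correction [CompleteSpace K] (h₀ : IsMAccretive T₀) (hAcl : A.IsClosed)
    (hA : (sqrt T₀).domain ≤ A.domain) (hB : Dense (B.adjoint.domain : Set K)) {E : ℝ} (hE : 0 < E)
    (hN : ∀ μ ≥ E, normProduct T₀ A B μ ≤ ENNReal.ofReal (1 / 2))
    (hfin : ∀ μ ≥ E, opNorm (comp (invSqrt T₀ μ) B.adjoint).closure ≠ ∞)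
    {z : ℂ} (hz : z ∈ katoSet T₀ A B) :
    ∃ Y : ℝ → H →L[ℂ] H, ContinuousOn Y (Ioi 0) ∧
      (∀ x, 0 < x → IsResolvent (katoOperator T₀ A B z) (-((x + E : ℝ) : ℂ))
        (posResolvent T₀ (x + E) - resolventSqrt (posResolvent T₀) E * Y x)) ∧
      ∀ x, 0 < x → ‖Y x‖ₑ ≤ ENNReal.ofReal (4 * (√(x + E))⁻¹) * normProduct T₀ A B (x + E) := by
  have hr := h₀.isPseudoResolvent
  obtain ⟨Γ, Φ, hd, -⟩ := exists_isKatoData h₀ hAcl hA hB hE (hfin E le_rfl)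
  set S : H →L[ℂ] H := resolventSqrt (posResolvent T₀) E with hS
  have hSS : ∀ x, S (S x) = posResolvent T₀ E x := fun x =>
    congrArg (fun X : H →L[ℂ] H => X x) (hr.resolventSqrt_mul_self hE)
  let c : ℝ → ℂ := fun x => -((x + E : ℝ) : ℂ) - -(E : ℂ)
  let r : ℝ → H →L[ℂ] H := fun x => posResolvent T₀ (x + E)
  let G : ℝ → H →L[ℂ] K := fun x => Γ ∘L S + c x • (Γ ∘L S) ∘L r x
  let Q : ℝ → K →L[ℂ] K := fun x => -(Γ ∘L Φ) - c x • G x ∘L (S ∘L Φ)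
  let L : ℝ → K →L[ℂ] K := fun x => Ring.inverse (1 - Q x)
  -- `S (1 + c r)` is `(T₀ + E)^{1/2} (T₀ + x + E)⁻¹`, so that `S Z` is the closure of
  -- `(T₀ + x + E)⁻¹ B*`.
  let Z : ℝ → K →L[ℂ] H := fun x => Φ + c x • (S ∘L (1 + c x • r x)) ∘L (S ∘L Φ)
  have hdx : ∀ x, 0 < x → IsKatoData T₀ A B (-((x + E : ℝ) : ℂ)) (r x) (G x)
      (S ∘L Φ + c x • r x ∘L (S ∘L Φ)) (Q x) := fun x hx =>
    hd.transfer (h₀.isResolvent (by positivity))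
  have hSZ : ∀ x, 0 < x → S ∘L Z x = S ∘L Φ + c x • r x ∘L (S ∘L Φ) := by
    intro x hx
    have h1 : ∀ y, S (S y) + c x • S (S (r x y)) = r x y := by
      intro y
      have h2 := (hdx x hx).resolvent_sub_apply hd y
      have h3 : r x (posResolvent T₀ E y) = posResolvent T₀ E (r x y) :=
        congrArg (fun X : H →L[ℂ] H => X y) (hr.comm (by positivity : 0 < x + E) hE)
      rw [h3] at h2
      rw [hSS, hSS, ← sub_eq_iff_eq_add'.1 h2]
    ext v
    have h2 := h1 (S (Φ v))
    simp only [Z, ContinuousLinearMap.comp_apply, add_apply, smul_apply, map_add, map_smul,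
      one_apply_eq_self] at h2 ⊢
    rw [h2]
  have hfac : ∀ x, 0 < x → ∃ (Γ' : H →L[ℂ] K) (Φ' : K →L[ℂ] H),
      Q x = -(Γ' ∘L Φ') ∧ G x = Γ' ∘L resolventSqrt (posResolvent T₀) (x + E) ∧
      Z x = (1 - sqrtDiff (posResolvent T₀) E (x + E) * resolventSqrt (posResolvent T₀) (x + E)) ∘L
        Φ' ∧ ‖Γ'‖ₑ * ‖Φ'‖ₑ ≤ normProduct T₀ A B (x + E) := by
    intro x hx
    have hxE : 0 < x + E := by positivity
    obtain ⟨Γ', Φ', hd', hn⟩ := exists_isKatoData h₀ hAcl hA hB hxE (hfin (x + E) (by linarith))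
    refine ⟨Γ', Φ', (hdx x hx).middle_eq hB hd', (hdx x hx).left_eq hd', ?_, hn⟩
    have h1 : S ∘L Z x = resolventSqrt (posResolvent T₀) (x + E) ∘L Φ' :=
      (hSZ x hx).trans ((hdx x hx).right_eq hB hd')
    ext v
    refine resolventSqrt_injective h₀ hE ?_
    have h2 := congrArg (fun X : K →L[ℂ] H => X v) h1
    have h3 := congrArg (fun X : H →L[ℂ] H => X (Φ' v))
      (hr.resolventSqrt_mul_one_sub hE (by linarith : E ≤ x + E) (h₀.isLeftRegular hxE))
    exact h2.trans h3.symm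
  have hQ : ∀ x, 0 < x → ‖Q x‖ ≤ 1 / 2 := by
    intro x hx
    obtain ⟨Γ', Φ', hQ, -, -, hn⟩ := hfac x hx
    have h1 := hn.trans (hN (x + E) (by linarith))
    rw [← ofReal_norm, ← ofReal_norm, ← ENNReal.ofReal_mul (norm_nonneg _),
      ENNReal.ofReal_le_ofReal_iff (by norm_num)] at h1
    rw [hQ, norm_neg]
    exact (ContinuousLinearMap.opNorm_comp_le _ _).trans h1
  have hu : ∀ x, 0 < x → IsUnit (1 - Q x) := fun x hx =>
    isUnit_one_sub_of_norm_lt_one ((hQ x hx).trans_lt (by norm_num))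
  refine ⟨fun x => Z x ∘L L x ∘L G x, ?_, fun x hx => ?_, fun x hx => ?_⟩
  · have hrc : ContinuousOn r (Ioi 0) := hr.continuousOn_add hE.le
    have hc : ContinuousOn c (Ioi 0) := by
      have : Continuous c := by fun_prop
      exact this.continuousOn
    have hGc : ContinuousOn G (Ioi 0) :=
      continuousOn_const.add (hc.smul (continuousOn_const.clm_comp hrc))
    have hQc : ContinuousOn Q (Ioi 0) :=
      continuousOn_const.sub (hc.smul (hGc.clm_comp continuousOn_const))
    have hLc : ContinuousOn L (Ioi 0) := by
      intro x hx
      obtain ⟨U, hU⟩ := hu x hx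
      have h1 := NormedRing.inverse_continuousAt U
      rw [hU] at h1
      exact ContinuousAt.comp_continuousWithinAt (f := fun x => 1 - Q x) h1
        (continuousWithinAt_const.sub (hQc x hx))
    have hZc : ContinuousOn Z (Ioi 0) :=
      continuousOn_const.add (hc.smul ((continuousOn_const.clm_comp
        (continuousOn_const.add (hc.smul hrc))).clm_comp continuousOn_const))
    exact hZc.clm_comp (hLc.clm_comp hGc)
  · have hdz := hd.transfer (isResolvent_resolvent hz.1)
    have huz := hz.2
    rw [hdz.birmanSchwinger_eq hB, spectrum.mem_resolventSet_iff, map_one] at huz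
    have h1 := hdz.isResolvent_katoOperator hB hAcl (hdx x hx) huz (hu x hx)
    rw [← hSZ x hx] at h1
    exact h1
  · obtain ⟨Γ', Φ', -, hG, hZ, hn⟩ := hfac x hx
    have hxE : 0 < x + E := by positivity
    have h1 : ‖Z x‖ ≤ 2 * ‖Φ'‖ := by
      rw [hZ]
      refine (ContinuousLinearMap.opNorm_comp_le _ _).trans ?_
      gcongr
      exact hr.norm_one_sub_sqrtDiff_mul_le hE (by linarith) ContinuousLinearMap.norm_id_le
    have h2 : ‖G x‖ ≤ ‖Γ'‖ * (√(x + E))⁻¹ := by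
      rw [hG]
      refine (ContinuousLinearMap.opNorm_comp_le _ _).trans ?_
      gcongr
      exact hr.norm_resolventSqrt_le hxE
    have h3 : ‖L x‖ ≤ 2 := norm_inverse_one_sub_le (hu x hx) (hQ x hx)
    have h4 : ‖Z x ∘L L x ∘L G x‖ ≤ 4 * (√(x + E))⁻¹ * (‖Γ'‖ * ‖Φ'‖) :=
      calc _ ≤ ‖Z x‖ * (‖L x‖ * ‖G x‖) :=
            (ContinuousLinearMap.opNorm_comp_le _ _).trans
              (by gcongr; exact ContinuousLinearMap.opNorm_comp_le _ _)
        _ ≤ 2 * ‖Φ'‖ * (2 * (‖Γ'‖ * (√(x + E))⁻¹)) := by gcongr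
        _ = _ := by ring
    calc ‖Z x ∘L L x ∘L G x‖ₑ ≤ ENNReal.ofReal (4 * (√(x + E))⁻¹ * (‖Γ'‖ * ‖Φ'‖)) := by
          rw [← ofReal_norm]
          exact ENNReal.ofReal_le_ofReal h4
      _ = ENNReal.ofReal (4 * (√(x + E))⁻¹) * (‖Γ'‖ₑ * ‖Φ'‖ₑ) := by
          rw [ENNReal.ofReal_mul (by positivity), ENNReal.ofReal_mul (norm_nonneg _), ofReal_norm,
            ofReal_norm]
      _ ≤ _ := by gcongr

end Comparison

end SqrtDomain

end

theorem theorem2p4 {H K : Type*}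
    [NormedAddCommGroup H] [InnerProductSpace ℂ H] [CompleteSpace H]
    [NormedAddCommGroup K] [InnerProductSpace ℂ K] [CompleteSpace K]
    (T₀ : H →ₗ.[ℂ] H) (A B : H →ₗ.[ℂ] K)
    (hKato : SqrtDomain.KatoHypotheses T₀ A B)
    (hSqrt : SqrtDomain.SqrtHypotheses T₀ A B)
    (z : ℂ) (hz : z ∈ SqrtDomain.katoSet T₀ A B)
    (hT : SqrtDomain.IsMAccretive (SqrtDomain.katoOperator T₀ A B z)) :
    (SqrtDomain.sqrt (SqrtDomain.katoOperator T₀ A B z)).domain = (SqrtDomain.sqrt T₀).domain := by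
  have h₀ := hSqrt.mAccretive
  -- If `A` vanishes on `dom T₀`, then `T = T₀`; otherwise `N(μ) < ∞` bounds both factors of `N(μ)`.
  by_cases hA : ∀ u : T₀.domain, A ⟨u, hKato.dom_A u.2⟩ = 0
  · rw [SqrtDomain.katoOperator_eq_of_forall_eq_zero hKato.dom_A hA hz.1]
  obtain ⟨R, hR, E₀, -, -, hdec, hN⟩ := hSqrt.decay
  have hB := SqrtDomain.dense_adjoint_domain hKato.closed_B
  set c := ∫⁻ x in Set.Ioc 0 R, ENNReal.ofReal (x ^ (-(1 / 2) : ℝ)) with hc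
  have hc_top : c ≠ ∞ := (SqrtDomain.lintegral_rpow_weight_lt_top R).ne
  -- The two parts of the integral of `Y` are at most `4 δ c ≤ 1/2` and `4 (1/8) = 1/2`.
  set δ : ℝ := 1 / (8 * (c.toReal + 1)) with hδ
  have hc0 : 0 ≤ c.toReal := ENNReal.toReal_nonneg
  have hδ0 : 0 < δ := by positivity
  have hδ1 : δ ≤ 1 / 2 := by
    rw [hδ, div_le_div_iff₀ (by positivity) (by norm_num)]
    linarith
  have hδc : 4 * ENNReal.ofReal δ * c ≤ ENNReal.ofReal (1 / 2) := by
    rw [← ENNReal.ofReal_toReal hc_top, show (4 : ℝ≥0∞) = ENNReal.ofReal 4 by norm_num,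
      ← ENNReal.ofReal_mul (by norm_num), ← ENNReal.ofReal_mul (by positivity)]
    refine ENNReal.ofReal_le_ofReal ?_
    rw [hδ, mul_one_div, div_mul_eq_mul_div, div_le_div_iff₀ (by positivity) (by norm_num)]
    linarith
  obtain ⟨E₁, hE₁⟩ := Filter.eventually_atTop.1
    (hN.eventually (Iic_mem_nhds (ENNReal.ofReal_pos.2 hδ0)))
  obtain ⟨E₂, hE₂⟩ := Filter.eventually_atTop.1
    (hdec.eventually (Iic_mem_nhds (ENNReal.ofReal_pos.2 (by norm_num : (0 : ℝ) < 1 / 8))))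
  set E := max 1 (max E₁ E₂)
  have hE : 1 ≤ E := le_max_left _ _
  have hE0 : 0 < E := one_pos.trans_le hE
  have hNE : ∀ μ ≥ E, SqrtDomain.normProduct T₀ A B μ ≤ ENNReal.ofReal δ := fun μ hμ =>
    hE₁ μ (((le_max_left _ _).trans (le_max_right _ _)).trans hμ)
  have hdE : SqrtDomain.decayIntegral T₀ A B R E ≤ ENNReal.ofReal (1 / 8) :=
    hE₂ E ((le_max_right _ _).trans (le_max_right _ _))
  obtain ⟨Y, hYc, hY, hYn⟩ := SqrtDomain.exists_kato_correction h₀ hKato.closed_A hSqrt.dom_A hB hE0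
    (fun μ hμ => (hNE μ hμ).trans (ENNReal.ofReal_le_ofReal hδ1))
    (fun μ hμ => SqrtDomain.opNorm_closure_ne_top h₀ hKato.dom_A hA (hE0.trans_le hμ)
      ((hNE μ hμ).trans_lt ENNReal.ofReal_lt_top).ne) hz
  refine SqrtDomain.sqrt_domain_eq_of_lintegral_le h₀ hT hE0 hYc
    (fun x hx => (hY x hx).resolvent_eq) ?_
  refine (SqrtDomain.lintegral_weight_le hR hE ENNReal.ofReal_ne_top hNE hYn).trans ?_
  calc _ ≤ ENNReal.ofReal (1 / 2) + 4 * ENNReal.ofReal (1 / 8) := by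
        gcongr
        exact hdE
    _ = 1 := by
        rw [show (4 : ℝ≥0∞) = ENNReal.ofReal 4 by norm_num, ← ENNReal.ofReal_mul (by norm_num),
          ← ENNReal.ofReal_add (by norm_num) (by norm_num)]
        norm_num
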